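/- Throughout, $k$ is a field, $\otimes=\otimes_k$, and the identity map of a vector space $V$ is also written $V$. For an (associative, possibly non-unital) $k$-algebra $A$ with multiplication $\mu$, write $(a\otimes 1)(x\otimes y)=ax\otimes y$, $(1\otimes a)(x\otimes y)=x\otimes ay$, and similarly on the right. For a linear map $f$ on two tensor factors, $f^{13}$ denotes $f$ acting on the first and third of three factors. **Multipliers.** Let $A$ be idempotent ($\mu$ is surjective) and non-degenerate ($ab=0\ \forall b$ implies $a=0$, and $ba=0\ \forall b$ implies $a=0$). A multiplier $m\in\mathbb M(A)$ is a pair of linear maps $m(-),(-)m:A\to A$ with $a(mb)=(am)b$ for all $a,b$. $\mathbb M(A)$ is a unital algebra containing $A$ and $\mathbb M(A)\otimes\mathbb M(A)\to\mathbb M(A\otimes A)$ is the evident map. **Weak multiplier bialgebras.** A weak multiplier bialgebra over $k$ is an idempotent non-degenerate algebra $A$ with linear maps $E_1,E_2,T_1,T_2:A\otimes A\to A\otimes A$ and $\epsilon:A\to k$ such that, for all $a,b,c,d\in A$: 1. $(a\otimes b)E_1(c\otimes d)=E_2(a\otimes b)(c\otimes d)$; $\ E_1^2=E_1$. 2. $(T_2\otimes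 A)(A\otimes T_1)=(A\otimes T_1)(T_2\otimes A)$; $\ (\epsilon\otimes A)T_1=\mu=(A\otimes\epsilon)T_2$; $\ (\mu\otimes A)T_1^{13}(A\otimes T_1)=T_1(\mu\otimes A)$. 3. $\langle T_1(a\otimes c)(b\otimes 1)\,|\,a,b,c\in A\rangle=\langle E_1(b\otimes c)\,|\,b,c\in A\rangle$ and $\langle(1\otimes c)T_2(b\otimes a)\,|\,a,b,c\in A\rangle=\langle E_2(b\otimes c)\,|\,b,c\in A\rangle$, where $\langle\ \rangle$ is the linear span. 4. $(E_1\otimes A)(A\otimes T_1)=(A\otimes T_1)(E_1\otimes A)$ and $(E_2\otimes A)(A\otimes T_2)=(A\otimes T_2)E_2^{13}$. 5. $(\epsilon\otimes A)((1\otimes a)E_1(b\otimes c))=(\epsilon\otimes A)(T_1(a\otimes c)(b\otimes1))$ and $(\epsilon\otimes A)(E_2(a\otimes b)(1\otimes c))=(\epsilon\otimes A)((1\otimes b)T_2(a\otimes c))$. It is regular if there are linear maps $T_3,T_4:A\otimes A\to A\otimes A$ with $(1\otimes a)T_1(c\otimes b)=T_3(c\otimes a)(1\otimes b)$ and $T_2(a\otimes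 c)(b\otimes1)=(a\otimes1)T_4(b\otimes c)$. Its comultiplication is right full if $\langle(A\otimes\omega)T_1(a\otimes b)\,|\,a,b\in A,\ \omega:A\to k\text{ linear}\rangle=A$. Put $E=(E_1,E_2)\in\mathbb M(A\otimes A)$, and let $\sqcap^R,\overline\sqcap^R:A\to\mathbb M(A)$ be given by $$\sqcap^R(a)b=(A\otimes\epsilon)T_3(b\otimes a),\quad b\sqcap^R(a)=(A\otimes\epsilon)E_2(b\otimes a),\quad \overline\sqcap^R(a)b=(A\otimes\epsilon)E_1(b\otimes a),\quad b\overline\sqcap^R(a)=(A\otimes\epsilon)T_1(b\otimes a).$$ **Comodules.** A right comodule over a regular weak multiplier bialgebra $A$ is a vector space $V$ with linear maps $\lambda,\varrho:V\otimes A\to V\otimes A$ such that $(1\otimes a)\lambda(v\otimes b)=\varrho(v\otimes a)(1\otimes b)$, $\ (\lambda\otimes A)\lambda^{13}(V\otimes E_1)=(\lambda\otimes A)\lambda^{13}$ and $(\lambda\otimes A)\lambda^{13}(V\otimes T_1)=(V\otimes T_1)(\lambda\otimes A)$. A homomorphism $(V,\lambda,\varrho)\to(V',\lambda',\varrho')$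 is a linear map $f:V\to V'$ with $\lambda'(f\otimes A)=(f\otimes A)\lambda$ and $\varrho'(f\otimes A)=(f\otimes A)\varrho$. **Right integrals.** For a linear map $\psi:A\to k$ and $a\in A$, let $a\leftharpoonup\psi\in\mathbb M(A)$ be given by $(a\leftharpoonup\psi)b=(\psi\otimes A)T_1(a\otimes b)$ and $b(a\leftharpoonup\psi)=(\psi\otimes A)T_3(a\otimes b)$. Then $\psi$ is a right integral if $a\leftharpoonup\psi\in\sqcap^R(A)$ for all $a\in A$. **Theorem.** Let $A$ be a regular weak multiplier bialgebra over $k$ with right full comultiplication, and let $R=\sqcap^R(A)\subseteq\mathbb M(A)$. Then: - $(A,T_1,T_3)$ is a right $A$-comodule. - $(R,\ r\otimes a\mapsto E(1\otimes ra),\ r\otimes a\mapsto(1\otimes ar)E)$ is a right $A$-comodule; that is, there is exactly one right $A$-comodule structure on $R$ whose structure maps are given by these formulas after composition with $R\otimes A\to\mathbb M(A\otimes A)$. - There is a unique linear map $\varepsilon:R\to k$ with $\varepsilon(\sqcap^R(a))=\epsilon(a)$ for all $a\in A$. - There is a unique multiplier $F$ on $A\otimes A$ with, for all $a,b,c\in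 A$ and with $\mathsf{tw}$ the flip, $$F(a\otimes bc)=((\overline\sqcap^R\otimes A)\,\mathsf{tw}\,T_4(c\otimes b))(a\otimes1),\qquad(ab\otimes c)F=(1\otimes c)((A\otimes\sqcap^R)T_2(a\otimes b)),$$ and there is a unique linear map $A\to A\otimes R$, denoted $(-\otimes1)F$, whose value at $a$ is mapped to the multiplier $(a\otimes1)F$ under $A\otimes R\to\mathbb M(A\otimes A)$. - The assignment $\Psi\mapsto\varepsilon\Psi$ is a linear isomorphism from the space of comodule homomorphisms $(A,T_1,T_3)\to R$ onto the space of right integrals on $A$, with inverse $\psi\mapsto(\psi\otimes R)((-\otimes1)F)$. -/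

import Mathlib

open scoped TensorProduct

namespace WMB

section Legs

variable {k : Type*} [Field k]
variable {V W V' W' : Type*} [AddCommGroup V] [Module k V] [AddCommGroup W] [Module k W]
  [AddCommGroup V'] [Module k V'] [AddCommGroup W'] [Module k W']

/-- The map `f ⊗ Z : V ⊗ W ⊗ Z → V' ⊗ W' ⊗ Z` (triple tensor products are bracketed to the
right). -/
noncomputable def leg12 (Z : Type*) [AddCommGroup Z] [Module k Z]
    (f : V ⊗[k] W →ₗ[k] V' ⊗[k] W') : V ⊗[k] (W ⊗[k] Z) →ₗ[k] V' ⊗[k] (W' ⊗[k] Z) :=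
  (TensorProduct.assoc k V' W' Z).toLinearMap ∘ₗ f.rTensor Z ∘ₗ
    (TensorProduct.assoc k V W Z).symm.toLinearMap

/-- The map `f ^ 13 = (V' ⊗ tw) (f ⊗ Z) (V ⊗ tw) : V ⊗ Z ⊗ W → V' ⊗ Z ⊗ W'`. -/
noncomputable def leg13 (Z : Type*) [AddCommGroup Z] [Module k Z]
    (f : V ⊗[k] W →ₗ[k] V' ⊗[k] W') : V ⊗[k] (Z ⊗[k] W) →ₗ[k] V' ⊗[k] (Z ⊗[k] W') :=
  (TensorProduct.comm k W' Z).toLinearMap.lTensor V' ∘ₗ leg12 Z f ∘ₗ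
    (TensorProduct.comm k Z W).toLinearMap.lTensor V

/-- The map `ω ⊗ W : V ⊗ W → k ⊗ W ≅ W` for a linear functional `ω` on `V`. -/
noncomputable def evalL (W : Type*) [AddCommGroup W] [Module k W] (ω : V →ₗ[k] k) :
    V ⊗[k] W →ₗ[k] W :=
  (TensorProduct.lid k W).toLinearMap ∘ₗ ω.rTensor W

/-- The map `V ⊗ ω : V ⊗ W → V ⊗ k ≅ V` for a linear functional `ω` on `W`. -/
noncomputable def evalR (V : Type*) [AddCommGroup V] [Module k V] (ω : W →ₗ[k] k) :
    V ⊗[k] W →ₗ[k] V :=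
  (TensorProduct.rid k V).toLinearMap ∘ₗ ω.lTensor V

end Legs

section Actions

variable {k : Type*} [Field k] {A : Type*} [NonUnitalRing A] [Module k A]
  [IsScalarTower k A A] [SMulCommClass k A A]

/-- `x ↦ (a ⊗ 1) x` on `A ⊗ V`. -/
noncomputable def left₁ (V : Type*) [AddCommGroup V] [Module k V] (a : A) :
    A ⊗[k] V →ₗ[k] A ⊗[k] V := (LinearMap.mulLeft k a).rTensor V

/-- `x ↦ x (a ⊗ 1)` on `A ⊗ V`. -/
noncomputable def right₁ (V : Type*) [AddCommGroup V] [Module k V] (a : A) :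
    A ⊗[k] V →ₗ[k] A ⊗[k] V := (LinearMap.mulRight k a).rTensor V

/-- `x ↦ (1 ⊗ a) x` on `V ⊗ A`. -/
noncomputable def left₂ (V : Type*) [AddCommGroup V] [Module k V] (a : A) :
    V ⊗[k] A →ₗ[k] V ⊗[k] A := (LinearMap.mulLeft k a).lTensor V

/-- `x ↦ x (1 ⊗ a)` on `V ⊗ A`. -/
noncomputable def right₂ (V : Type*) [AddCommGroup V] [Module k V] (a : A) :
    V ⊗[k] A →ₗ[k] V ⊗[k] A := (LinearMap.mulRight k a).lTensor V

end Actions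

section MultiplierAlgebra

variable (k : Type*) [Field k] (A : Type*) [NonUnitalRing A] [Module k A]
  [IsScalarTower k A A] [SMulCommClass k A A]

/-- The multiplier algebra of `A`: the pairs `(l, r)` of linear maps `A → A` with
`a * l b = r a * b`, with product `(l, r) (l', r') = (l l', r' r)`. -/
noncomputable def Multiplier : Subalgebra k (Module.End k A × (Module.End k A)ᵐᵒᵖ) where
  carrier := {m | ∀ a b : A, a * m.1 b = m.2.unop a * b}
  mul_mem' := by
    intro m n hm hn a b
    change ∀ a b : A, a * m.1 b = m.2.unop a * b at hm
    change ∀ a b : A, a * n.1 b = n.2.unop a * b at hn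
    simp [hm, hn]
  add_mem' := by
    intro m n hm hn a b
    change ∀ a b : A, a * m.1 b = m.2.unop a * b at hm
    change ∀ a b : A, a * n.1 b = n.2.unop a * b at hn
    simp [hm, hn, mul_add, add_mul]
  algebraMap_mem' := by
    intro c a b
    simp [Module.algebraMap_end_apply, mul_smul_comm, smul_mul_assoc]

variable {k A}

/-- `lact m a` is the product `m a` in `A` of the multiplier `m` with `a`. -/
noncomputable def lact : Multiplier k A →ₗ[k] A →ₗ[k] A :=
  LinearMap.fst k _ _ ∘ₗ (Multiplier k A).toSubmodule.subtype

/-- `ract m a` is the product `a m` in `A` of `a` with the multiplier `m`. -/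
noncomputable def ract : Multiplier k A →ₗ[k] A →ₗ[k] A :=
  (MulOpposite.opLinearEquiv k).symm.toLinearMap ∘ₗ LinearMap.snd k _ _ ∘ₗ
    (Multiplier k A).toSubmodule.subtype

theorem mul_lact (m : Multiplier k A) (a b : A) : a * lact m b = ract m a * b := m.2 a b

theorem lact_mul (m n : Multiplier k A) (a : A) : lact (m * n) a = lact m (lact n a) := rfl

theorem ract_mul (m n : Multiplier k A) (a : A) : ract (m * n) a = ract n (ract m a) := rfl

/-- The multiplier with given left and right actions on `A`. -/
noncomputable def mkMultiplier (l r : A →ₗ[k] A) (h : ∀ a b : A, a * l b = r a * b) :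
    Multiplier k A := ⟨(l, MulOpposite.op r), h⟩

/-- The element `a` of `A` regarded as the multiplier `(a (-), (-) a)`. -/
noncomputable def ofAlg : A →ₗ[k] Multiplier k A where
  toFun a := mkMultiplier (LinearMap.mulLeft k a) (LinearMap.mulRight k a)
    (fun b c => by simp [mul_assoc])
  map_add' a b := by
    apply Subtype.ext
    refine Prod.ext ?_ (MulOpposite.unop_injective ?_) <;> ext c <;>
      simp [mkMultiplier, add_mul, mul_add]
  map_smul' r a := by
    apply Subtype.ext
    refine Prod.ext ?_ (MulOpposite.unop_injective ?_) <;> ext c <;>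
      simp [mkMultiplier, mul_smul_comm, smul_mul_assoc]

/-- The multiplier `m ⊗ n` on `A ⊗ A`, for multipliers `m` and `n` on `A`. -/
noncomputable def tmulMultiplier (m n : Multiplier k A) : Multiplier k (A ⊗[k] A) :=
  mkMultiplier (TensorProduct.map (lact m) (lact n)) (TensorProduct.map (ract m) (ract n)) (by
    intro x y
    induction x using TensorProduct.induction_on with
    | zero => simp
    | add x x' hx hx' => simp only [add_mul, map_add, hx, hx']
    | tmul a b =>
      induction y using TensorProduct.induction_on with
      | zero => simp
      | add y y' hy hy' => simp only [mul_add, map_add, hy, hy']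
      | tmul c d => simp [mul_lact])

/-- The canonical linear map `M(A) ⊗ M(A) → M(A ⊗ A)`. -/
noncomputable def tensorMultiplier :
    Multiplier k A ⊗[k] Multiplier k A →ₗ[k] Multiplier k (A ⊗[k] A) :=
  TensorProduct.lift (LinearMap.mk₂ k tmulMultiplier
    (fun m m' n => by
      apply Subtype.ext
      refine Prod.ext ?_ (MulOpposite.unop_injective ?_) <;> ext c d <;>
        simp [tmulMultiplier, mkMultiplier, TensorProduct.add_tmul])
    (fun r m n => by
      apply Subtype.ext
      refine Prod.ext ?_ (MulOpposite.unop_injective ?_) <;> ext c d <;>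
        simp [tmulMultiplier, mkMultiplier, TensorProduct.smul_tmul'])
    (fun m n n' => by
      apply Subtype.ext
      refine Prod.ext ?_ (MulOpposite.unop_injective ?_) <;> ext c d <;>
        simp [tmulMultiplier, mkMultiplier, TensorProduct.tmul_add])
    (fun r m n => by
      apply Subtype.ext
      refine Prod.ext ?_ (MulOpposite.unop_injective ?_) <;> ext c d <;>
        simp [tmulMultiplier, mkMultiplier, TensorProduct.tmul_smul]))

end MultiplierAlgebra

section Bialgebra

/-- A weak multiplier bialgebra structure on the (possibly non-unital) algebra `A` over `k`. -/
structure WeakMultiplierBialgebra (k : Type*) [Field k] (A : Type*) [NonUnitalRing A]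
    [Module k A] [IsScalarTower k A A] [SMulCommClass k A A] where
  /-- `A` is idempotent -/
  idempotent : Function.Surjective (LinearMap.mul' k A)
  /-- `A` is non-degenerate -/
  nondeg_right : ∀ a : A, (∀ b : A, a * b = 0) → a = 0
  nondeg_left : ∀ a : A, (∀ b : A, b * a = 0) → a = 0
  E₁ : A ⊗[k] A →ₗ[k] A ⊗[k] A
  E₂ : A ⊗[k] A →ₗ[k] A ⊗[k] A
  T₁ : A ⊗[k] A →ₗ[k] A ⊗[k] A
  T₂ : A ⊗[k] A →ₗ[k] A ⊗[k] A
  /-- the counit `ϵ : A → k` -/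
  counit : A →ₗ[k] k
  /-- `(a ⊗ b) E₁(c ⊗ d) = E₂(a ⊗ b) (c ⊗ d)` -/
  E_mult : ∀ a b c d : A, (a ⊗ₜ[k] b) * E₁ (c ⊗ₜ[k] d) = E₂ (a ⊗ₜ[k] b) * (c ⊗ₜ[k] d)
  /-- `E₁² = E₁` -/
  E_idem : E₁ ∘ₗ E₁ = E₁
  /-- `(T₂ ⊗ A) (A ⊗ T₁) = (A ⊗ T₁) (T₂ ⊗ A)` -/
  coassoc : leg12 A T₂ ∘ₗ T₁.lTensor A = T₁.lTensor A ∘ₗ leg12 A T₂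
  /-- `(ϵ ⊗ A) T₁ = μ` -/
  counit_left : evalL A counit ∘ₗ T₁ = LinearMap.mul' k A
  /-- `(A ⊗ ϵ) T₂ = μ` -/
  counit_right : evalR A counit ∘ₗ T₂ = LinearMap.mul' k A
  /-- `(μ ⊗ A) T₁^13 (A ⊗ T₁) = T₁ (μ ⊗ A)` -/
  T_mul : ((LinearMap.mul' k A).rTensor A ∘ₗ (TensorProduct.assoc k A A A).symm.toLinearMap) ∘ₗ
      leg13 A T₁ ∘ₗ T₁.lTensor A =
    T₁ ∘ₗ (LinearMap.mul' k A).rTensor A ∘ₗ (TensorProduct.assoc k A A A).symm.toLinearMap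
  /-- `⟨T₁(a ⊗ c) (b ⊗ 1) | a, b, c⟩ = ⟨E₁(b ⊗ c) | b, c⟩` -/
  span_E₁ : Submodule.span k {x | ∃ a b c : A, x = right₁ A b (T₁ (a ⊗ₜ[k] c))} =
    Submodule.span k {x | ∃ b c : A, x = E₁ (b ⊗ₜ[k] c)}
  /-- `⟨(1 ⊗ c) T₂(b ⊗ a) | a, b, c⟩ = ⟨E₂(b ⊗ c) | b, c⟩` -/
  span_E₂ : Submodule.span k {x | ∃ a b c : A, x = left₂ A c (T₂ (b ⊗ₜ[k] a))} =
    Submodule.span k {x | ∃ b c : A, x = E₂ (b ⊗ₜ[k] c)}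
  /-- `(E₁ ⊗ A) (A ⊗ T₁) = (A ⊗ T₁) (E₁ ⊗ A)` -/
  E_T₁ : leg12 A E₁ ∘ₗ T₁.lTensor A = T₁.lTensor A ∘ₗ leg12 A E₁
  /-- `(E₂ ⊗ A) (A ⊗ T₂) = (A ⊗ T₂) E₂^13` -/
  E_T₂ : leg12 A E₂ ∘ₗ T₂.lTensor A = T₂.lTensor A ∘ₗ leg13 A E₂
  /-- `(ϵ ⊗ A)((1 ⊗ a) E₁(b ⊗ c)) = (ϵ ⊗ A)(T₁(a ⊗ c) (b ⊗ 1))` -/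
  counit_E₁ : ∀ a b c : A, evalL A counit (left₂ A a (E₁ (b ⊗ₜ[k] c))) =
    evalL A counit (right₁ A b (T₁ (a ⊗ₜ[k] c)))
  /-- `(ϵ ⊗ A)(E₂(a ⊗ b) (1 ⊗ c)) = (ϵ ⊗ A)((1 ⊗ b) T₂(a ⊗ c))` -/
  counit_E₂ : ∀ a b c : A, evalL A counit (right₂ A c (E₂ (a ⊗ₜ[k] b))) =
    evalL A counit (left₂ A b (T₂ (a ⊗ₜ[k] c)))

/-- A regular weak multiplier bialgebra; the maps `T₃` and `T₄` are determined by the rest of the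
structure. -/
structure RegularWeakMultiplierBialgebra (k : Type*) [Field k] (A : Type*) [NonUnitalRing A]
    [Module k A] [IsScalarTower k A A] [SMulCommClass k A A]
    extends WeakMultiplierBialgebra k A where
  T₃ : A ⊗[k] A →ₗ[k] A ⊗[k] A
  T₄ : A ⊗[k] A →ₗ[k] A ⊗[k] A
  /-- `(1 ⊗ a) T₁(c ⊗ b) = T₃(c ⊗ a) (1 ⊗ b)` -/
  regular_T₃ : ∀ a b c : A, left₂ A a (T₁ (c ⊗ₜ[k] b)) = right₂ A b (T₃ (c ⊗ₜ[k] a))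
  /-- `T₂(a ⊗ c) (b ⊗ 1) = (a ⊗ 1) T₄(b ⊗ c)` -/
  regular_T₄ : ∀ a b c : A, right₁ A b (T₂ (a ⊗ₜ[k] c)) = left₁ A a (T₄ (b ⊗ₜ[k] c))

end Bialgebra


section Lemmas

set_option linter.unusedSectionVars false

variable {k : Type*} [Field k]

theorem eq_zero_of_evalL {V W : Type*} [AddCommGroup V] [Module k V] [AddCommGroup W] [Module k W]
    (x : V ⊗[k] W) (h : ∀ ω : V →ₗ[k] k, evalL W ω x = 0) : x = 0 := by
  classical
  let b := Module.Free.chooseBasis k V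
  apply (TensorProduct.equivFinsuppOfBasisLeft b).injective
  ext i
  rw [TensorProduct.equivFinsuppOfBasisLeft_apply]
  simpa [evalL] using h (b.coord i)

theorem eq_zero_of_evalR {V W : Type*} [AddCommGroup V] [Module k V] [AddCommGroup W] [Module k W]
    (x : V ⊗[k] W) (h : ∀ ω : W →ₗ[k] k, evalR V ω x = 0) : x = 0 := by
  classical
  let b := Module.Free.chooseBasis k W
  apply (TensorProduct.equivFinsuppOfBasisRight b).injective
  ext i
  rw [TensorProduct.equivFinsuppOfBasisRight_apply]
  simpa [evalR] using h (b.coord i)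

variable {A : Type*} [NonUnitalRing A] [Module k A] [IsScalarTower k A A] [SMulCommClass k A A]
variable {V : Type*} [AddCommGroup V] [Module k V]

@[simp] theorem evalL_tmul {W : Type*} [AddCommGroup W] [Module k W] (ω : V →ₗ[k] k) (v : V)
    (w : W) : evalL W ω (v ⊗ₜ[k] w) = ω v • w := by simp [evalL]

@[simp] theorem evalR_tmul {W : Type*} [AddCommGroup W] [Module k W] (ω : W →ₗ[k] k) (v : V)
    (w : W) : evalR V ω (v ⊗ₜ[k] w) = ω w • v := by simp [evalR]

@[simp] theorem left₁_tmul (a b : A) (v : V) : left₁ V a (b ⊗ₜ[k] v) = (a * b) ⊗ₜ[k] v := rfl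
@[simp] theorem right₁_tmul (a b : A) (v : V) : right₁ V a (b ⊗ₜ[k] v) = (b * a) ⊗ₜ[k] v := rfl
@[simp] theorem left₂_tmul (a b : A) (v : V) : left₂ V a (v ⊗ₜ[k] b) = v ⊗ₜ[k] (a * b) := rfl
@[simp] theorem right₂_tmul (a b : A) (v : V) : right₂ V a (v ⊗ₜ[k] b) = v ⊗ₜ[k] (b * a) := rfl

theorem evalL_left₂ (ω : V →ₗ[k] k) (a : A) (x : V ⊗[k] A) :
    evalL A ω (left₂ V a x) = a * evalL A ω x := by
  induction x using TensorProduct.induction_on with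
  | zero => simp
  | add x y hx hy => simp [hx, hy, mul_add]
  | tmul v b => simp [mul_smul_comm]

theorem evalL_right₂ (ω : V →ₗ[k] k) (a : A) (x : V ⊗[k] A) :
    evalL A ω (right₂ V a x) = evalL A ω x * a := by
  induction x using TensorProduct.induction_on with
  | zero => simp
  | add x y hx hy => simp [hx, hy, add_mul]
  | tmul v b => simp [smul_mul_assoc]

theorem evalR_left₁ (ω : V →ₗ[k] k) (a : A) (x : A ⊗[k] V) :
    evalR A ω (left₁ V a x) = a * evalR A ω x := by
  induction x using TensorProduct.induction_on with
  | zero => simp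
  | add x y hx hy => simp [hx, hy, mul_add]
  | tmul v b => simp [mul_smul_comm]

theorem evalR_right₁ (ω : V →ₗ[k] k) (a : A) (x : A ⊗[k] V) :
    evalR A ω (right₁ V a x) = evalR A ω x * a := by
  induction x using TensorProduct.induction_on with
  | zero => simp
  | add x y hx hy => simp [hx, hy, add_mul]
  | tmul v b => simp [smul_mul_assoc]

theorem left_comm (a b : A) (x : A ⊗[k] A) :
    left₁ A a (left₂ A b x) = left₂ A b (left₁ A a x) := by
  induction x using TensorProduct.induction_on with
  | zero => simp
  | add x y hx hy => simp [hx, hy]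
  | tmul v b => simp

theorem right_comm (a b : A) (x : A ⊗[k] A) :
    right₁ A a (right₂ A b x) = right₂ A b (right₁ A a x) := by
  induction x using TensorProduct.induction_on with
  | zero => simp
  | add x y hx hy => simp [hx, hy]
  | tmul v b => simp

theorem left₁_right₁ (a b : A) (x : A ⊗[k] V) :
    left₁ V a (right₁ V b x) = right₁ V b (left₁ V a x) := by
  induction x using TensorProduct.induction_on with
  | zero => simp
  | add x y hx hy => simp [hx, hy]
  | tmul v b => simp [mul_assoc]

theorem left₁_right₂ (a b : A) (x : A ⊗[k] A) :
    left₁ A a (right₂ A b x) = right₂ A b (left₁ A a x) := by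
  induction x using TensorProduct.induction_on with
  | zero => simp
  | add x y hx hy => simp [hx, hy]
  | tmul v b => simp

theorem left₂_right₁ (a b : A) (x : A ⊗[k] A) :
    left₂ A a (right₁ A b x) = right₁ A b (left₂ A a x) := by
  induction x using TensorProduct.induction_on with
  | zero => simp
  | add x y hx hy => simp [hx, hy]
  | tmul v b => simp

theorem left₂_right₂ (a b : A) (x : V ⊗[k] A) :
    left₂ V a (right₂ V b x) = right₂ V b (left₂ V a x) := by
  induction x using TensorProduct.induction_on with
  | zero => simp
  | add x y hx hy => simp [hx, hy]
  | tmul v b => simp [mul_assoc]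

theorem tmul_mul (a b : A) (x : A ⊗[k] A) : (a ⊗ₜ[k] b) * x = left₁ A a (left₂ A b x) := by
  induction x using TensorProduct.induction_on with
  | zero => simp
  | add x y hx hy => simp [hx, hy, mul_add]
  | tmul v b => simp

theorem mul_tmul (a b : A) (x : A ⊗[k] A) : x * (a ⊗ₜ[k] b) = right₁ A a (right₂ A b x) := by
  induction x using TensorProduct.induction_on with
  | zero => simp
  | add x y hx hy => simp [hx, hy, add_mul]
  | tmul v b => simp

namespace WeakMultiplierBialgebra

theorem cancel_left₁ (B : WeakMultiplierBialgebra k A) {x y : A ⊗[k] V} (h : ∀ a : A, left₁ V a x = left₁ V a y) : x = y := by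
  rw [← sub_eq_zero]
  refine eq_zero_of_evalR _ fun ω => B.nondeg_left _ fun a => ?_
  rw [← evalR_left₁, map_sub, h, sub_self, map_zero]

theorem cancel_right₁ (B : WeakMultiplierBialgebra k A) {x y : A ⊗[k] V} (h : ∀ a : A, right₁ V a x = right₁ V a y) : x = y := by
  rw [← sub_eq_zero]
  refine eq_zero_of_evalR _ fun ω => B.nondeg_right _ fun a => ?_
  rw [← evalR_right₁, map_sub, h, sub_self, map_zero]

theorem cancel_left₂ (B : WeakMultiplierBialgebra k A) {x y : V ⊗[k] A} (h : ∀ a : A, left₂ V a x = left₂ V a y) : x = y := by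
  rw [← sub_eq_zero]
  refine eq_zero_of_evalL _ fun ω => B.nondeg_left _ fun a => ?_
  rw [← evalL_left₂, map_sub, h, sub_self, map_zero]

theorem cancel_right₂ (B : WeakMultiplierBialgebra k A) {x y : V ⊗[k] A} (h : ∀ a : A, right₂ V a x = right₂ V a y) : x = y := by
  rw [← sub_eq_zero]
  refine eq_zero_of_evalL _ fun ω => B.nondeg_right _ fun a => ?_
  rw [← evalL_right₂, map_sub, h, sub_self, map_zero]

theorem cancel_mul (B : WeakMultiplierBialgebra k A) {x y : A ⊗[k] A}
    (h : ∀ a b : A, x * (a ⊗ₜ[k] b) = y * (a ⊗ₜ[k] b)) : x = y := by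
  refine B.cancel_right₂ fun b => B.cancel_right₁ fun a => ?_
  rw [← mul_tmul, ← mul_tmul, h]

variable (B : WeakMultiplierBialgebra k A)

/-- `(a ⊗ 1) T₁(c ⊗ b) = T₂(a ⊗ c) (1 ⊗ b)` -/
theorem left₁_T₁ (a b c : A) :
    left₁ A a (B.T₁ (c ⊗ₜ[k] b)) = right₂ A b (B.T₂ (a ⊗ₜ[k] c)) := by
  have h := LinearMap.congr_fun B.coassoc (a ⊗ₜ[k] (c ⊗ₜ[k] b))
  have h1 : ∀ x : A ⊗[k] A, (evalL A B.counit).lTensor A (leg12 A B.T₂ (a ⊗ₜ[k] x)) =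
      left₁ A a x := by
    intro x
    induction x using TensorProduct.induction_on with
    | zero => simp
    | add x y hx hy => simp only [TensorProduct.tmul_add, map_add, hx, hy]
    | tmul u v =>
      have h2 := LinearMap.congr_fun B.counit_right (a ⊗ₜ[k] u)
      simp only [LinearMap.comp_apply, LinearMap.mul'_apply] at h2
      simp only [left₁_tmul, ← h2, leg12, LinearMap.comp_apply, LinearEquiv.coe_coe,
        TensorProduct.assoc_symm_tmul, LinearMap.rTensor_tmul]
      generalize B.T₂ (a ⊗ₜ[k] u) = w
      induction w using TensorProduct.induction_on with
      | zero => simp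
      | add x y hx hy => simp only [TensorProduct.add_tmul, map_add, hx, hy]
      | tmul s t => simp [TensorProduct.smul_tmul]
  have h3 : ∀ x : A ⊗[k] A, (evalL A B.counit).lTensor A (B.T₁.lTensor A
      (TensorProduct.assoc k A A A (x ⊗ₜ[k] b))) = right₂ A b x := by
    intro x
    induction x using TensorProduct.induction_on with
    | zero => simp
    | add x y hx hy => simp only [TensorProduct.add_tmul, map_add, hx, hy]
    | tmul u v =>
      have h2 := LinearMap.congr_fun B.counit_left (v ⊗ₜ[k] b)
      simp only [LinearMap.comp_apply, LinearMap.mul'_apply] at h2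
      simp [h2]
  rw [← h1, ← h3]
  have h4 := congrArg ((evalL A B.counit).lTensor A) h
  simpa [leg12] using h4

/-- Left multiplication by `Δ(a)` on `A ⊗ A`. -/
noncomputable def comulL (a : A) : A ⊗[k] A →ₗ[k] A ⊗[k] A :=
  TensorProduct.lift (LinearMap.mk₂ k (fun x y => right₁ A x (B.T₁ (a ⊗ₜ[k] y)))
    (fun x x' y => by
      generalize B.T₁ (a ⊗ₜ[k] y) = w
      induction w using TensorProduct.induction_on with
      | zero => simp
      | add u v hu hv => rw [map_add, hu, hv, map_add, map_add]; abel
      | tmul u v => simp [mul_add, TensorProduct.add_tmul])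
    (fun r x y => by
      generalize B.T₁ (a ⊗ₜ[k] y) = w
      induction w using TensorProduct.induction_on with
      | zero => simp
      | add u v hu hv => rw [map_add, hu, hv, map_add, smul_add]
      | tmul u v => simp [mul_smul_comm, TensorProduct.smul_tmul'])
    (fun x y y' => by simp [TensorProduct.tmul_add])
    (fun r x y => by simp [TensorProduct.tmul_smul]))

/-- Right multiplication by `Δ(a)` on `A ⊗ A`. -/
noncomputable def comulR (a : A) : A ⊗[k] A →ₗ[k] A ⊗[k] A :=
  TensorProduct.lift (LinearMap.mk₂ k (fun x y => left₂ A y (B.T₂ (x ⊗ₜ[k] a)))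
    (fun x x' y => by simp [TensorProduct.add_tmul])
    (fun r x y => by simp [← TensorProduct.smul_tmul'])
    (fun x y y' => by
      generalize B.T₂ (x ⊗ₜ[k] a) = w
      induction w using TensorProduct.induction_on with
      | zero => simp
      | add u v hu hv => rw [map_add, hu, hv, map_add, map_add]; abel
      | tmul u v => simp [add_mul, TensorProduct.tmul_add])
    (fun r x y => by
      generalize B.T₂ (x ⊗ₜ[k] a) = w
      induction w using TensorProduct.induction_on with
      | zero => simp
      | add u v hu hv => rw [map_add, hu, hv, map_add, smul_add]
      | tmul u v => simp [smul_mul_assoc]))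

@[simp] theorem comulL_tmul (a x y : A) :
    B.comulL a (x ⊗ₜ[k] y) = right₁ A x (B.T₁ (a ⊗ₜ[k] y)) := rfl

@[simp] theorem comulR_tmul (a x y : A) :
    B.comulR a (x ⊗ₜ[k] y) = left₂ A y (B.T₂ (x ⊗ₜ[k] a)) := rfl

theorem mul_comulL (a : A) (w z : A ⊗[k] A) : w * B.comulL a z = B.comulR a w * z := by
  induction w using TensorProduct.induction_on with
  | zero => simp
  | add u v hu hv => simp only [map_add, add_mul, hu, hv]
  | tmul x y =>
    induction z using TensorProduct.induction_on with
    | zero => simp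
    | add u v hu hv => simp only [map_add, mul_add, hu, hv]
    | tmul u v =>
      simp only [comulL_tmul, comulR_tmul, tmul_mul, mul_tmul]
      rw [left₂_right₁, left₁_right₁, left_comm, left₁_T₁, left₂_right₂]

theorem comulL_mul (a b : A) (z : A ⊗[k] A) :
    B.comulL (a * b) z = B.comulL a (B.comulL b z) := by
  induction z using TensorProduct.induction_on with
  | zero => simp
  | add u v hu hv => simp only [map_add, hu, hv]
  | tmul x y =>
    have h := LinearMap.congr_fun B.T_mul (a ⊗ₜ[k] (b ⊗ₜ[k] y))
    simp only [LinearMap.comp_apply, LinearEquiv.coe_coe, TensorProduct.assoc_symm_tmul,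
      LinearMap.rTensor_tmul, LinearMap.lTensor_tmul, LinearMap.mul'_apply] at h
    rw [comulL_tmul, ← h, comulL_tmul]
    generalize B.T₁ (b ⊗ₜ[k] y) = w
    induction w using TensorProduct.induction_on with
    | zero => simp
    | add u v hu hv => simp only [TensorProduct.tmul_add, map_add, hu, hv]
    | tmul u v =>
      simp only [leg13, leg12, LinearMap.comp_apply, LinearEquiv.coe_coe, LinearMap.lTensor_tmul,
        TensorProduct.comm_tmul, TensorProduct.assoc_symm_tmul, LinearMap.rTensor_tmul,
        right₁_tmul, comulL_tmul]
      generalize B.T₁ (a ⊗ₜ[k] v) = w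
      induction w using TensorProduct.induction_on with
      | zero => simp
      | add u v hu hv => simp only [TensorProduct.add_tmul, map_add, hu, hv]
      | tmul s t => simp [mul_assoc]

theorem comulR_mul (a b : A) (w : A ⊗[k] A) :
    B.comulR (a * b) w = B.comulR b (B.comulR a w) := by
  refine B.cancel_mul fun u v => ?_
  rw [← mul_comulL, comulL_mul, mul_comulL, mul_comulL]

theorem T₂_mul (x a b : A) : B.T₂ (x ⊗ₜ[k] (a * b)) = B.comulR b (B.T₂ (x ⊗ₜ[k] a)) := by
  refine B.cancel_left₂ fun y => ?_
  rw [← comulR_tmul, comulR_mul, comulR_tmul]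
  generalize B.T₂ (x ⊗ₜ[k] a) = w
  induction w using TensorProduct.induction_on with
  | zero => simp
  | add u v hu hv => simp only [map_add, hu, hv]
  | tmul u v =>
    simp only [left₂_tmul, comulR_tmul]
    generalize B.T₂ (u ⊗ₜ[k] b) = w
    induction w using TensorProduct.induction_on with
    | zero => simp
    | add u v hu hv => simp only [map_add, hu, hv]
    | tmul u v => simp [mul_assoc]

theorem mul_E₁ (w z : A ⊗[k] A) : w * B.E₁ z = B.E₂ w * z := by
  induction w using TensorProduct.induction_on with
  | zero => simp
  | add u v hu hv => simp only [map_add, add_mul, hu, hv]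
  | tmul x y =>
    induction z using TensorProduct.induction_on with
    | zero => simp
    | add u v hu hv => simp only [map_add, mul_add, hu, hv]
    | tmul u v => exact B.E_mult x y u v

theorem E₂_idem (w : A ⊗[k] A) : B.E₂ (B.E₂ w) = B.E₂ w := by
  refine B.cancel_mul fun u v => ?_
  rw [← mul_E₁, ← mul_E₁, ← mul_E₁]
  exact congrArg _ (LinearMap.congr_fun B.E_idem _)

theorem E₁_comulL (a : A) (z : A ⊗[k] A) : B.E₁ (B.comulL a z) = B.comulL a z := by
  have key : ∀ x ∈ Submodule.span k {x | ∃ b c : A, x = B.E₁ (b ⊗ₜ[k] c)}, B.E₁ x = x := by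
    intro x hx
    induction hx using Submodule.span_induction with
    | mem x h => obtain ⟨b, c, rfl⟩ := h; exact LinearMap.congr_fun B.E_idem _
    | zero => simp
    | add x y _ _ hx hy => rw [map_add, hx, hy]
    | smul r x _ hx => rw [map_smul, hx]
  induction z using TensorProduct.induction_on with
  | zero => simp
  | add u v hu hv => simp only [map_add, hu, hv]
  | tmul x y =>
    apply key
    rw [← B.span_E₁]
    exact Submodule.subset_span ⟨a, x, y, rfl⟩

theorem E₂_comulR (a : A) (w : A ⊗[k] A) : B.E₂ (B.comulR a w) = B.comulR a w := by
  have key : ∀ x ∈ Submodule.span k {x | ∃ b c : A, x = B.E₂ (b ⊗ₜ[k] c)}, B.E₂ x = x := by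
    intro x hx
    induction hx using Submodule.span_induction with
    | mem x h => obtain ⟨b, c, rfl⟩ := h; exact B.E₂_idem _
    | zero => simp
    | add x y _ _ hx hy => rw [map_add, hx, hy]
    | smul r x _ hx => rw [map_smul, hx]
  induction w using TensorProduct.induction_on with
  | zero => simp
  | add u v hu hv => simp only [map_add, hu, hv]
  | tmul x y =>
    apply key
    rw [← B.span_E₂]
    exact Submodule.subset_span ⟨a, x, y, rfl⟩

/-- `Δ(a) E = Δ(a)` -/
theorem comulL_E₁ (a : A) (z : A ⊗[k] A) : B.comulL a (B.E₁ z) = B.comulL a z := by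
  have h : ∀ w : A ⊗[k] A, w * B.comulL a (B.E₁ z) = w * B.comulL a z := by
    intro w
    rw [mul_comulL, mul_E₁, E₂_comulR, mul_comulL]
  refine B.cancel_left₂ fun y => B.cancel_left₁ fun x => ?_
  rw [← tmul_mul, ← tmul_mul, h]

/-- `E Δ(a) = Δ(a)` -/
theorem comulR_E₂ (a : A) (w : A ⊗[k] A) : B.comulR a (B.E₂ w) = B.comulR a w := by
  refine B.cancel_mul fun u v => ?_
  rw [← mul_comulL, ← mul_E₁, E₁_comulL, mul_comulL]

end WeakMultiplierBialgebra

end Lemmas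

section Projections

set_option linter.unusedSectionVars false

variable {k : Type*} [Field k]
  {A : Type*} [NonUnitalRing A] [Module k A] [IsScalarTower k A A] [SMulCommClass k A A]

namespace WeakMultiplierBialgebra

variable (B : WeakMultiplierBialgebra k A)

theorem evalL_T₁ (a b : A) : evalL A B.counit (B.T₁ (a ⊗ₜ[k] b)) = a * b :=
  LinearMap.congr_fun B.counit_left (a ⊗ₜ[k] b)

theorem evalR_T₂ (a b : A) : evalR A B.counit (B.T₂ (a ⊗ₜ[k] b)) = a * b :=
  LinearMap.congr_fun B.counit_right (a ⊗ₜ[k] b)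

theorem counit_evalL (w : A ⊗[k] A) :
    B.counit (evalL A B.counit w) = B.counit (evalR A B.counit w) := by
  induction w using TensorProduct.induction_on with
  | zero => simp
  | add u v hu hv => simp only [map_add, hu, hv]
  | tmul u v => simp [mul_comm]

/-- `ϵ(b z y) = ϵ(b z₁) ϵ(z₂ y)` -/
theorem counit_mul_mul (b z y : A) :
    B.counit (evalL A B.counit (left₁ A b (B.T₁ (z ⊗ₜ[k] y)))) = B.counit (b * z * y) := by
  have h : evalL A B.counit (B.T₂ (b ⊗ₜ[k] z)) * y = evalL A B.counit (B.T₂ (b ⊗ₜ[k] (z * y))) := by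
    rw [← sub_eq_zero]
    refine B.nondeg_left _ fun d => ?_
    rw [mul_sub, ← mul_assoc, ← evalL_left₂, ← evalL_left₂, ← counit_E₂, ← counit_E₂, evalL_right₂,
      evalL_right₂, mul_assoc, sub_self]
  rw [left₁_T₁, evalL_right₂, h, counit_evalL, evalR_T₂, mul_assoc]

/-- `(bq)₁ ϵ((bq)₂ y) = b q₁ ϵ(q₂ y)` -/
theorem evalR_T₁_mul (b q y : A) :
    evalR A B.counit (B.T₁ ((b * q) ⊗ₜ[k] y)) = b * evalR A B.counit (B.T₁ (q ⊗ₜ[k] y)) := by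
  have claim : ∀ w : A ⊗[k] A, evalR A B.counit (right₂ A y (B.comulR q w)) =
      evalR A B.counit (B.comulR (evalR A B.counit (B.T₁ (q ⊗ₜ[k] y))) w) := by
    intro w
    induction w using TensorProduct.induction_on with
    | zero => simp
    | add u v hu hv => simp only [map_add, hu, hv]
    | tmul p c =>
      have h := congrArg (evalR A (B.counit ∘ₗ evalL A B.counit ∘ₗ left₁ A c))
        (LinearMap.congr_fun B.coassoc (p ⊗ₜ[k] (q ⊗ₜ[k] y)))
      simp only [LinearMap.comp_apply, LinearMap.lTensor_tmul] at h
      have h1 : ∀ x : A ⊗[k] A, evalR A (B.counit ∘ₗ evalL A B.counit ∘ₗ left₁ A c)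
          (leg12 A B.T₂ (p ⊗ₜ[k] x)) = evalR A B.counit (B.comulR (evalR A B.counit x)
            (p ⊗ₜ[k] c)) := by
        intro x
        induction x using TensorProduct.induction_on with
        | zero => simp
        | add x y hx hy =>
          simp only [TensorProduct.tmul_add, map_add, hx, hy, comulR_tmul]
        | tmul u v =>
          simp only [leg12, LinearMap.comp_apply, LinearEquiv.coe_coe,
            TensorProduct.assoc_symm_tmul, LinearMap.rTensor_tmul, comulR_tmul, evalR_tmul,
            TensorProduct.tmul_smul, map_smul]
          generalize B.T₂ (p ⊗ₜ[k] u) = w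
          induction w using TensorProduct.induction_on with
          | zero => simp
          | add x y hx hy => simp only [TensorProduct.add_tmul, map_add, hx, hy, smul_add]
          | tmul s t => simp [smul_smul, mul_comm]
      rw [h1] at h
      rw [h]
      simp only [leg12, LinearMap.comp_apply, LinearEquiv.coe_coe,
        TensorProduct.assoc_symm_tmul, LinearMap.rTensor_tmul, comulR_tmul]
      generalize B.T₂ (p ⊗ₜ[k] q) = w
      induction w using TensorProduct.induction_on with
      | zero => simp
      | add x y hx hy => simp only [TensorProduct.add_tmul, map_add, hx, hy]
      | tmul s t => simp [counit_mul_mul]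
  rw [← sub_eq_zero]
  refine B.nondeg_left _ fun p => ?_
  rw [mul_sub, ← evalR_left₁, left₁_T₁, T₂_mul, claim, ← T₂_mul, evalR_T₂, sub_self]

theorem mul_evalR_E₁ (a b c : A) :
    b * evalR A B.counit (B.E₁ (c ⊗ₜ[k] a)) = evalR A B.counit (B.T₁ (b ⊗ₜ[k] a)) * c := by
  have key : ∀ w ∈ Submodule.span k {x | ∃ a b c : A, x = right₁ A b (B.T₁ (a ⊗ₜ[k] c))},
      b * evalR A B.counit w = evalR A B.counit (B.comulL b w) := by
    intro w hw
    induction hw using Submodule.span_induction with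
    | mem x h =>
      obtain ⟨q, x, y, rfl⟩ := h
      rw [← comulL_tmul, ← comulL_mul, comulL_tmul, comulL_tmul, evalR_right₁, evalR_right₁,
        evalR_T₁_mul, mul_assoc]
    | zero => simp
    | add x y _ _ hx hy => rw [map_add, map_add, map_add, mul_add, hx, hy]
    | smul r x _ hx => rw [map_smul, map_smul, map_smul, mul_smul_comm, hx]
  rw [key _ (by rw [B.span_E₁]; exact Submodule.subset_span ⟨c, a, rfl⟩), comulL_E₁, comulL_tmul,
    evalR_right₁]

/-- The map `a ↦ ⊓̄ᴿ(a)` from `A` to its multiplier algebra, where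
`⊓̄ᴿ(a) b = (A ⊗ ϵ) E₁(b ⊗ a)` and `b ⊓̄ᴿ(a) = (A ⊗ ϵ) T₁(b ⊗ a)`. -/
noncomputable def barPiR : A →ₗ[k] Multiplier k A where
  toFun a := mkMultiplier
    (evalR A B.counit ∘ₗ B.E₁ ∘ₗ (TensorProduct.mk k A A).flip a)
    (evalR A B.counit ∘ₗ B.T₁ ∘ₗ (TensorProduct.mk k A A).flip a)
    (fun b c => by simpa using B.mul_evalR_E₁ a b c)
  map_add' a b := by
    apply Subtype.ext
    refine Prod.ext ?_ (MulOpposite.unop_injective ?_) <;> ext c <;>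
      simp [mkMultiplier]
  map_smul' r a := by
    apply Subtype.ext
    refine Prod.ext ?_ (MulOpposite.unop_injective ?_) <;> ext c <;>
      simp [mkMultiplier]

/-- The canonical idempotent `E = (E₁, E₂)`, a multiplier on `A ⊗ A`. -/
noncomputable def E : Multiplier k (A ⊗[k] A) :=
  mkMultiplier B.E₁ B.E₂ (fun x y => B.mul_E₁ x y)

end WeakMultiplierBialgebra

namespace RegularWeakMultiplierBialgebra

variable (B : RegularWeakMultiplierBialgebra k A)

theorem right₂_T₄ (a b c : A) :
    right₂ A b (B.T₄ (a ⊗ₜ[k] c)) = right₁ A a (B.T₁ (c ⊗ₜ[k] b)) := by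
  refine B.cancel_left₁ fun d => ?_
  rw [left₁_right₂, ← B.regular_T₄, ← right_comm, ← B.left₁_T₁, ← left₁_right₁]

theorem left₁_T₃ (x y q : A) :
    left₁ A x (B.T₃ (q ⊗ₜ[k] y)) = left₂ A y (B.T₂ (x ⊗ₜ[k] q)) := by
  refine B.cancel_right₂ fun d => ?_
  rw [← left₁_right₂, ← B.regular_T₃, left_comm, B.left₁_T₁, left₂_right₂]

theorem evalR_T₄ (a b : A) : evalR A B.counit (B.T₄ (a ⊗ₜ[k] b)) = b * a := by
  rw [← sub_eq_zero]
  refine B.nondeg_left _ fun d => ?_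
  rw [mul_sub, ← evalR_left₁, ← B.regular_T₄, evalR_right₁, B.evalR_T₂, mul_assoc, sub_self]

/-- `ϵ(y z u) = ϵ(y z₂) ϵ(z₁ u)` -/
theorem counit_mul_mul' (y z u : A) :
    B.counit (evalL A B.counit (right₁ A u (B.T₃ (z ⊗ₜ[k] y)))) = B.counit (y * z * u) := by
  have h : evalL A B.counit (right₁ A u (B.T₃ (z ⊗ₜ[k] y))) =
      evalL A B.counit (B.T₄ (u ⊗ₜ[k] (y * z))) := by
    rw [← sub_eq_zero]
    refine B.nondeg_right _ fun c => ?_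
    rw [sub_mul, ← evalL_right₂, ← evalL_right₂, right₂_T₄, ← right_comm, ← B.regular_T₃,
      ← left₂_right₁, evalL_left₂, ← B.counit_E₁, ← B.counit_E₁, evalL_left₂, evalL_left₂,
      mul_assoc, sub_self]
  rw [h, B.counit_evalL, evalR_T₄]

/-- `(T₂ ⊗ A) (A ⊗ T₃) = (A ⊗ T₃) (T₂ ⊗ A)` -/
theorem coassoc_T₃ (x q y : A) : leg12 A B.T₂ (x ⊗ₜ[k] B.T₃ (q ⊗ₜ[k] y)) =
    B.T₃.lTensor A (leg12 A B.T₂ (x ⊗ₜ[k] (q ⊗ₜ[k] y))) := by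
  have e : ∀ d : A, ∀ t : A ⊗[k] (A ⊗[k] A), (TensorProduct.assoc k A A A).symm
      ((right₂ A d).lTensor A t) = right₂ (A ⊗[k] A) d ((TensorProduct.assoc k A A A).symm t) := by
    intro d t
    induction t using TensorProduct.induction_on with
    | zero => simp
    | add u v hu hv => simp only [map_add, hu, hv]
    | tmul u v =>
      induction v using TensorProduct.induction_on with
      | zero => simp
      | add s t hs ht => simp only [TensorProduct.tmul_add, map_add, hs, ht]
      | tmul s t => simp
  apply (TensorProduct.assoc k A A A).symm.injective
  refine B.cancel_right₂ fun d => ?_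
  rw [← e, ← e]
  congr 1
  have h1 : ∀ f : A →ₗ[k] A, ∀ z : A ⊗[k] A, (f.lTensor A).lTensor A (leg12 A B.T₂ (x ⊗ₜ[k] z)) =
      leg12 A B.T₂ (x ⊗ₜ[k] (f.lTensor A z)) := by
    intro f z
    induction z using TensorProduct.induction_on with
    | zero => simp
    | add u v hu hv => simp only [TensorProduct.tmul_add, map_add, hu, hv]
    | tmul u v =>
      simp only [leg12, LinearMap.comp_apply, LinearEquiv.coe_coe,
        TensorProduct.assoc_symm_tmul, LinearMap.rTensor_tmul, LinearMap.lTensor_tmul]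
      generalize B.T₂ (x ⊗ₜ[k] u) = w
      induction w using TensorProduct.induction_on with
      | zero => simp
      | add x y hx hy => simp only [TensorProduct.add_tmul, map_add, hx, hy]
      | tmul s t => simp
  have h2 : ∀ w : A ⊗[k] A, (right₂ A d).lTensor A (B.T₃.lTensor A
      (TensorProduct.assoc k A A A (w ⊗ₜ[k] y))) = (left₂ A y).lTensor A (B.T₁.lTensor A
        (TensorProduct.assoc k A A A (w ⊗ₜ[k] d))) := by
    intro w
    induction w using TensorProduct.induction_on with
    | zero => simp
    | add u v hu hv => simp only [TensorProduct.add_tmul, map_add, hu, hv]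
    | tmul u v => simp [B.regular_T₃]
  have h3 := LinearMap.congr_fun B.coassoc (x ⊗ₜ[k] (q ⊗ₜ[k] d))
  simp only [LinearMap.comp_apply, LinearMap.lTensor_tmul] at h3
  have h4 : B.T₃.lTensor A (leg12 A B.T₂ (x ⊗ₜ[k] (q ⊗ₜ[k] y))) = B.T₃.lTensor A
      (TensorProduct.assoc k A A A (B.T₂ (x ⊗ₜ[k] q) ⊗ₜ[k] y)) := by simp [leg12]
  have h5 : B.T₁.lTensor A (leg12 A B.T₂ (x ⊗ₜ[k] (q ⊗ₜ[k] d))) = B.T₁.lTensor A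
      (TensorProduct.assoc k A A A (B.T₂ (x ⊗ₜ[k] q) ⊗ₜ[k] d)) := by simp [leg12]
  rw [h4, h2, ← h5, ← h3]
  have h6 : right₂ A d (B.T₃ (q ⊗ₜ[k] y)) = left₂ A y (B.T₁ (q ⊗ₜ[k] d)) :=
    (B.regular_T₃ y d q).symm
  unfold right₂ left₂ at *
  rw [h1, h6, h1]

theorem evalR_T₃_mul (q c y : A) :
    evalR A B.counit (B.T₃ ((q * c) ⊗ₜ[k] y)) = evalR A B.counit (B.T₃ (q ⊗ₜ[k] y)) * c := by
  rw [← sub_eq_zero]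
  refine B.nondeg_left _ fun x => ?_
  rw [mul_sub, ← evalR_left₁, left₁_T₃, B.T₂_mul]
  have h1 : ∀ w : A ⊗[k] A, evalR A B.counit (left₂ A y (B.comulR c w)) =
      evalR A B.counit (B.comulR c ((evalR A B.counit).lTensor A
        (B.T₃.lTensor A (TensorProduct.assoc k A A A (w ⊗ₜ[k] y))))) := by
    intro w
    induction w using TensorProduct.induction_on with
    | zero => simp
    | add u v hu hv => simp only [TensorProduct.add_tmul, map_add, hu, hv]
    | tmul s t =>
      simp only [TensorProduct.assoc_tmul, LinearMap.lTensor_tmul,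
        WeakMultiplierBialgebra.comulR_tmul]
      generalize B.T₂ (s ⊗ₜ[k] c) = w
      induction w using TensorProduct.induction_on with
      | zero => simp
      | add x y hx hy => simp only [map_add, hx, hy]
      | tmul m n =>
        simp only [left₂_tmul, evalR_tmul]
        rw [← mul_assoc, ← counit_mul_mul', B.counit_evalL, evalR_right₁]
  have h2 : ∀ z : A ⊗[k] A, (evalR A B.counit).lTensor A (leg12 A B.T₂ (x ⊗ₜ[k] z)) =
      B.T₂ (x ⊗ₜ[k] evalR A B.counit z) := by
    intro z
    induction z using TensorProduct.induction_on with
    | zero => simp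
    | add u v hu hv => simp only [TensorProduct.tmul_add, map_add, hu, hv]
    | tmul u v =>
      simp only [leg12, LinearMap.comp_apply, LinearEquiv.coe_coe,
        TensorProduct.assoc_symm_tmul, LinearMap.rTensor_tmul, evalR_tmul,
        TensorProduct.tmul_smul, map_smul]
      generalize B.T₂ (x ⊗ₜ[k] u) = w
      induction w using TensorProduct.induction_on with
      | zero => simp
      | add x y hx hy => simp only [TensorProduct.add_tmul, map_add, hx, hy, smul_add]
      | tmul s t => simp
  have h3 : B.T₃.lTensor A (TensorProduct.assoc k A A A (B.T₂ (x ⊗ₜ[k] q) ⊗ₜ[k] y)) =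
      leg12 A B.T₂ (x ⊗ₜ[k] B.T₃ (q ⊗ₜ[k] y)) := by
    rw [coassoc_T₃]
    simp [leg12]
  rw [h1, h3, h2, ← B.T₂_mul, B.evalR_T₂, sub_self]

theorem mul_evalR_T₃ (a b c : A) :
    b * evalR A B.counit (B.T₃ (c ⊗ₜ[k] a)) = evalR A B.counit (B.E₂ (b ⊗ₜ[k] a)) * c := by
  have hR : ∀ q x y : A, B.comulR q (x ⊗ₜ[k] y) = left₁ A x (B.T₃ (q ⊗ₜ[k] y)) := by
    intro q x y
    rw [B.comulR_tmul, left₁_T₃]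
  have key : ∀ w ∈ Submodule.span k {x | ∃ a b c : A, x = left₂ A c (B.T₂ (b ⊗ₜ[k] a))},
      evalR A B.counit w * c = evalR A B.counit (B.comulR c w) := by
    intro w hw
    induction hw using Submodule.span_induction with
    | mem x h =>
      obtain ⟨q, x, y, rfl⟩ := h
      rw [← B.comulR_tmul, ← B.comulR_mul, hR, hR, evalR_left₁, evalR_left₁,
        evalR_T₃_mul, mul_assoc]
    | zero => simp
    | add x y _ _ hx hy => rw [map_add, map_add, map_add, add_mul, hx, hy]
    | smul r x _ hx => rw [map_smul, map_smul, map_smul, smul_mul_assoc, hx]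
  rw [key _ (by rw [B.span_E₂]; exact Submodule.subset_span ⟨b, a, rfl⟩), B.comulR_E₂, hR,
    evalR_left₁]

/-- The map `a ↦ ⊓ᴿ(a)` from `A` to its multiplier algebra, where
`⊓ᴿ(a) b = (A ⊗ ϵ) T₃(b ⊗ a)` and `b ⊓ᴿ(a) = (A ⊗ ϵ) E₂(b ⊗ a)`. -/
noncomputable def piR : A →ₗ[k] Multiplier k A where
  toFun a := mkMultiplier
    (evalR A B.counit ∘ₗ B.T₃ ∘ₗ (TensorProduct.mk k A A).flip a)
    (evalR A B.counit ∘ₗ B.E₂ ∘ₗ (TensorProduct.mk k A A).flip a)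
    (fun b c => by simpa using B.mul_evalR_T₃ a b c)
  map_add' a b := by
    apply Subtype.ext
    refine Prod.ext ?_ (MulOpposite.unop_injective ?_) <;> ext c <;>
      simp [mkMultiplier]
  map_smul' r a := by
    apply Subtype.ext
    refine Prod.ext ?_ (MulOpposite.unop_injective ?_) <;> ext c <;>
      simp [mkMultiplier]

/-- The base `R = ⊓ᴿ(A)`, as a subspace of the multiplier algebra. If the comultiplication is
right full, then it is also the range of `⊓̄ᴿ`. -/
noncomputable def base : Submodule k (Multiplier k A) := LinearMap.range B.piR

/-- The comultiplication is right full: `A` is spanned by the elements `(A ⊗ ω) T₁(a ⊗ b)`. -/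
def RightFull : Prop :=
  Submodule.span k {x : A | ∃ (a b : A) (ω : A →ₗ[k] k), x = evalR A ω (B.T₁ (a ⊗ₜ[k] b))} = ⊤

/-- `F` is the multiplier on `A ⊗ A` with
`F (a ⊗ b c) = ((⊓̄ᴿ ⊗ A) tw T₄(c ⊗ b)) (a ⊗ 1)` and
`(a b ⊗ c) F = (1 ⊗ c) ((A ⊗ ⊓ᴿ) T₂(a ⊗ b))`. -/
def IsF (F : Multiplier k (A ⊗[k] A)) : Prop :=
  (∀ a b c : A, lact F (a ⊗ₜ[k] (b * c)) =
    ((lact.flip a) ∘ₗ B.barPiR).rTensor A (TensorProduct.comm k A A (B.T₄ (c ⊗ₜ[k] b)))) ∧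
  (∀ a b c : A, ract F ((a * b) ⊗ₜ[k] c) =
    ((ract.flip c) ∘ₗ B.piR).lTensor A (B.T₂ (a ⊗ₜ[k] b)))

/-- The canonical map `A ⊗ R → M(A ⊗ A)`. -/
noncomputable def algTensorBase : A ⊗[k] B.base →ₗ[k] Multiplier k (A ⊗[k] A) :=
  tensorMultiplier ∘ₗ TensorProduct.map ofAlg B.base.subtype

/-- The canonical map `R ⊗ A → M(A ⊗ A)`. -/
noncomputable def baseTensorAlg : B.base ⊗[k] A →ₗ[k] Multiplier k (A ⊗[k] A) :=
  tensorMultiplier ∘ₗ TensorProduct.map B.base.subtype ofAlg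

/-- `D : A → A ⊗ R` is the map `a ↦ (a ⊗ 1) F`. -/
def IsLegF (F : Multiplier k (A ⊗[k] A)) (D : A →ₗ[k] A ⊗[k] B.base) : Prop :=
  ∀ a : A, B.algTensorBase (D a) = tensorMultiplier (ofAlg a ⊗ₜ[k] 1) * F

/-- `ε : R → k` is the counit of `R`: `ε(⊓ᴿ(a)) = ϵ(a)` for all `a`. -/
def IsBaseCounit (ε : B.base →ₗ[k] k) : Prop :=
  ∀ (a : A) (r : B.base), (r : Multiplier k A) = B.piR a → ε r = B.counit a

/-- For `ψ : A → k` and `a ∈ A`, the multiplier `a ↼ ψ` on `A` with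
`(a ↼ ψ) b = (ψ ⊗ A) T₁(a ⊗ b)` and `b (a ↼ ψ) = (ψ ⊗ A) T₃(a ⊗ b)`. -/
noncomputable def harpoon (a : A) (ψ : A →ₗ[k] k) : Multiplier k A :=
  mkMultiplier (evalL A ψ ∘ₗ B.T₁ ∘ₗ TensorProduct.mk k A A a)
    (evalL A ψ ∘ₗ B.T₃ ∘ₗ TensorProduct.mk k A A a) (fun b c => by
      simp only [LinearMap.comp_apply, TensorProduct.mk_apply]
      rw [← evalL_left₂, B.regular_T₃, evalL_right₂])

/-- The space of right integrals on `A`: the functionals `ψ` with `a ↼ ψ ∈ R` for all `a`. -/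
noncomputable def rightIntegrals : Submodule k (A →ₗ[k] k) where
  carrier := {ψ | ∀ a : A, B.harpoon a ψ ∈ B.base}
  add_mem' := by
    intro ψ φ hψ hφ a
    have h : B.harpoon a (ψ + φ) = B.harpoon a ψ + B.harpoon a φ := by
      apply Subtype.ext
      refine Prod.ext ?_ (MulOpposite.unop_injective ?_) <;> ext c <;>
        simp [harpoon, mkMultiplier, evalL, LinearMap.rTensor_add]
    rw [h]
    exact B.base.add_mem (hψ a) (hφ a)
  zero_mem' := by
    intro a
    have h : B.harpoon a 0 = 0 := by
      apply Subtype.ext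
      refine Prod.ext ?_ (MulOpposite.unop_injective ?_) <;> ext c <;>
        simp [harpoon, mkMultiplier, evalL]
    rw [h]
    exact B.base.zero_mem
  smul_mem' := by
    intro r ψ hψ a
    have h : B.harpoon a (r • ψ) = r • B.harpoon a ψ := by
      apply Subtype.ext
      refine Prod.ext ?_ (MulOpposite.unop_injective ?_) <;> ext c <;>
        simp [harpoon, mkMultiplier, evalL, LinearMap.rTensor_smul]
    rw [h]
    exact B.base.smul_mem r (hψ a)

end RegularWeakMultiplierBialgebra

/-- A right comodule over the regular weak multiplier bialgebra `B` on the vector space `V`. -/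
structure RightComodule (B : RegularWeakMultiplierBialgebra k A)
    (V : Type*) [AddCommGroup V] [Module k V] where
  lam : V ⊗[k] A →ₗ[k] V ⊗[k] A
  rho : V ⊗[k] A →ₗ[k] V ⊗[k] A
  /-- `(1 ⊗ a) lam(v ⊗ b) = rho(v ⊗ a) (1 ⊗ b)` -/
  compat : ∀ (v : V) (a b : A), left₂ V a (lam (v ⊗ₜ[k] b)) = right₂ V b (rho (v ⊗ₜ[k] a))
  /-- `(lam ⊗ A) lam^13 (V ⊗ E₁) = (lam ⊗ A) lam^13` -/
  normalized : leg12 A lam ∘ₗ leg13 A lam ∘ₗ B.E₁.lTensor V = leg12 A lam ∘ₗ leg13 A lam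
  /-- `(lam ⊗ A) lam^13 (V ⊗ T₁) = (V ⊗ T₁) (lam ⊗ A)` -/
  coassoc : leg12 A lam ∘ₗ leg13 A lam ∘ₗ B.T₁.lTensor V = B.T₁.lTensor V ∘ₗ leg12 A lam

namespace RightComodule

variable {B : RegularWeakMultiplierBialgebra k A}

/-- The space of comodule homomorphisms: linear maps commuting with both structure maps. -/
def homs {V V' : Type*} [AddCommGroup V] [Module k V] [AddCommGroup V'] [Module k V']
    (C : RightComodule B V) (C' : RightComodule B V') : Submodule k (V →ₗ[k] V') where
  carrier := {f | C'.lam ∘ₗ f.rTensor A = f.rTensor A ∘ₗ C.lam ∧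
    C'.rho ∘ₗ f.rTensor A = f.rTensor A ∘ₗ C.rho}
  add_mem' := by
    rintro f g ⟨hf, hf'⟩ ⟨hg, hg'⟩
    constructor
    · rw [LinearMap.rTensor_add, LinearMap.comp_add, LinearMap.add_comp, hf, hg]
    · rw [LinearMap.rTensor_add, LinearMap.comp_add, LinearMap.add_comp, hf', hg']
  zero_mem' := by constructor <;> simp
  smul_mem' := by
    rintro r f ⟨hf, hf'⟩
    constructor
    · rw [LinearMap.rTensor_smul, LinearMap.comp_smul, LinearMap.smul_comp, hf]
    · rw [LinearMap.rTensor_smul, LinearMap.comp_smul, LinearMap.smul_comp, hf']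

/-- `C` is the comodule `(A, T₁, T₃)`. -/
def IsRegular (C : RightComodule B A) : Prop := C.lam = B.T₁ ∧ C.rho = B.T₃

/-- `C` is the comodule `(R, r ⊗ a ↦ E (1 ⊗ r a), r ⊗ a ↦ (1 ⊗ a r) E)`, where the values are
identified with elements of the multiplier algebra of `A ⊗ A`. -/
def IsBase (C : RightComodule B B.base) : Prop :=
  (∀ (r : B.base) (a : A), B.baseTensorAlg (C.lam (r ⊗ₜ[k] a)) =
    B.E * tensorMultiplier (1 ⊗ₜ[k] ofAlg (lact (r : Multiplier k A) a))) ∧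
  (∀ (r : B.base) (a : A), B.baseTensorAlg (C.rho (r ⊗ₜ[k] a)) =
    tensorMultiplier (1 ⊗ₜ[k] ofAlg (ract (r : Multiplier k A) a)) * B.E)

end RightComodule

end Projections

end WMB

/-! Think of `Δ(a)` as the multiplier with `T₁(a ⊗ b) = Δ(a)(1 ⊗ b)`, so that `T₂(a ⊗ b) = (a ⊗
1)Δ(b)`, `T₃(a ⊗ b) = (1 ⊗ b)Δ(a)` and `T₄(a ⊗ b) = Δ(b)(a ⊗ 1)`. There is no unit. Identities are
therefore checked after multiplication by elements of `A` (non-degeneracy), and elements are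
decomposed into products (idempotence).

The base. Applying the counit to the middle leg of the compatibility of `E` with `T₁` and `T₃` gives
`E(1 ⊗ ab) = (⊓̄ᴿ ⊗ A)T₁(a ⊗ b)` and `(1 ⊗ ba)E = (⊓ᴿ ⊗ A)T₃(a ⊗ b)`. Comparing the two inside `(1 ⊗
cd)E(1 ⊗ ab)`, right fullness yields `⊓̄ᴿ(A) = ⊓ᴿ(A) = R` (`range_barPiR`). The first description of
`m ∈ R` gives `Δ(qm) = Δ(q)(1 ⊗ m)`, the second `Δ(mq) = (1 ⊗ m)Δ(q)`. Together they show that `E`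
commutes with `1 ⊗ m` (`E₁_lact_base`), which makes `R` a comodule (`exists_comodule`).

The counit of `R`. The point is that `ϵ` vanishes on the kernel of `⊓ᴿ` (`counit_eq_zero`): `ϵ(ba) =
(ϵ ⊗ ϵ)T₃(a ⊗ b)`, and this can be evaluated through a bilinear form that factors through `R ⊗ R`.

The multiplier `F`. Both prescribed formulas give the same value for `(a'b' ⊗ c')F(a ⊗ bc)`
(`F_compat`), so they descend to a multiplier.

The bijection. Both directions rest on the multiplier `a ↼ ψ`. If `Ψ` is a homomorphism, then `ε` on
the first leg of `(Ψ ⊗ A)T₃(a ⊗ b) = (1 ⊗ bΨ(a))E` gives `a ↼ (εΨ) = Ψ(a)` (`harpoon_counit_comp`),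
so `εΨ` is a right integral. If `ψ` is a right integral, coassociativity shows that `a ↦ a ↼ ψ` is a
homomorphism (`mem_homs_of_harpoon`), and `(ψ ⊗ R)((a ⊗ 1)F) = a ↼ ψ` (`incl_evalL_legF`). Finally
`ε` on the second leg of `(a ⊗ 1)F` returns `a`, hence `ψ` is recovered (`counit_evalL_legF`). -/

namespace WMB

/-! ### Multipliers and their actions on one leg of a tensor product. -/

section Multipliers

variable {k : Type*} [Field k] {A : Type*} [NonUnitalRing A] [Module k A]
  [IsScalarTower k A A] [SMulCommClass k A A]

@[simp] theorem lact_mkMultiplier (l r : A →ₗ[k] A) (h : ∀ a b : A, a * l b = r a * b) :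
    lact (mkMultiplier l r h) = l := rfl

@[simp] theorem ract_mkMultiplier (l r : A →ₗ[k] A) (h : ∀ a b : A, a * l b = r a * b) :
    ract (mkMultiplier l r h) = r := rfl

@[simp] theorem lact_one : lact (1 : Multiplier k A) = LinearMap.id := rfl

@[simp] theorem ract_one : ract (1 : Multiplier k A) = LinearMap.id := rfl

@[simp] theorem lact_ofAlg (a : A) : lact (ofAlg a : Multiplier k A) = LinearMap.mulLeft k a := rfl

@[simp] theorem ract_ofAlg (a : A) : ract (ofAlg a : Multiplier k A) = LinearMap.mulRight k a := rfl

@[simp] theorem lact_tensorMultiplier_tmul (m n : Multiplier k A) :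
    lact (tensorMultiplier (m ⊗ₜ[k] n)) = TensorProduct.map (lact m) (lact n) := by
  simp [tensorMultiplier, tmulMultiplier]

@[simp] theorem ract_tensorMultiplier_tmul (m n : Multiplier k A) :
    ract (tensorMultiplier (m ⊗ₜ[k] n)) = TensorProduct.map (ract m) (ract n) := by
  simp [tensorMultiplier, tmulMultiplier]

/-- Multipliers with the same actions from both sides are equal. -/
theorem multiplier_ext {m n : Multiplier k A} (hl : ∀ a, lact m a = lact n a)
    (hr : ∀ a, ract m a = ract n a) : m = n :=
  Subtype.ext (Prod.ext (LinearMap.ext hl) (MulOpposite.unop_injective (LinearMap.ext hr)))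

/-- The compatibility `a (m z) = (a m) z` lets the left action fix the right one as soon as elements
are separated by right multiplication. -/
theorem multiplier_ext_lact (hA : ∀ x y : A, (∀ z, x * z = y * z) → x = y)
    {m n : Multiplier k A} (h : ∀ a, lact m a = lact n a) : m = n :=
  multiplier_ext h fun a => hA _ _ fun z => by rw [← mul_lact, ← mul_lact, h]

theorem multiplier_ext_ract (hA : ∀ x y : A, (∀ z, z * x = z * y) → x = y)
    {m n : Multiplier k A} (h : ∀ a, ract m a = ract n a) : m = n :=
  multiplier_ext (fun a => hA _ _ fun z => by rw [mul_lact, mul_lact, h]) h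

variable {V : Type*} [AddCommGroup V] [Module k V] (W : Type*) [AddCommGroup W] [Module k W]

/-- Given `i : V → M(A)`, the map `v ⊗ w ↦ i(v) c ⊗ w`. -/
noncomputable def lapp (i : V →ₗ[k] Multiplier k A) (c : A) : V ⊗[k] W →ₗ[k] A ⊗[k] W :=
  (lact.flip c ∘ₗ i).rTensor W

/-- Given `i : V → M(A)`, the map `v ⊗ w ↦ c i(v) ⊗ w`. -/
noncomputable def rapp (i : V →ₗ[k] Multiplier k A) (c : A) : V ⊗[k] W →ₗ[k] A ⊗[k] W :=
  (ract.flip c ∘ₗ i).rTensor W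

variable {W}

@[simp] theorem lapp_tmul (i : V →ₗ[k] Multiplier k A) (c : A) (v : V) (w : W) :
    lapp W i c (v ⊗ₜ[k] w) = lact (i v) c ⊗ₜ[k] w := rfl

@[simp] theorem rapp_tmul (i : V →ₗ[k] Multiplier k A) (c : A) (v : V) (w : W) :
    rapp W i c (v ⊗ₜ[k] w) = ract (i v) c ⊗ₜ[k] w := rfl

theorem evalR_lapp (i : V →ₗ[k] Multiplier k A) (c : A) (ω : W →ₗ[k] k) (x : V ⊗[k] W) :
    evalR A ω (lapp W i c x) = lact (i (evalR V ω x)) c := by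
  induction x using TensorProduct.induction_on with
  | zero => simp
  | add x y hx hy => simp only [map_add, hx, hy, LinearMap.add_apply]
  | tmul v w => simp

theorem evalR_rapp (i : V →ₗ[k] Multiplier k A) (c : A) (ω : W →ₗ[k] k) (x : V ⊗[k] W) :
    evalR A ω (rapp W i c x) = ract (i (evalR V ω x)) c := by
  induction x using TensorProduct.induction_on with
  | zero => simp
  | add x y hx hy => simp only [map_add, hx, hy, LinearMap.add_apply]
  | tmul v w => simp

/-- This is `d (m c) = (d m) c` in the first leg; it exchanges identities for left actions with
identities for right actions. -/
theorem left₁_lapp (i : V →ₗ[k] Multiplier k A) (c d : A) (x : V ⊗[k] W) :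
    left₁ W d (lapp W i c x) = right₁ W c (rapp W i d x) := by
  induction x using TensorProduct.induction_on with
  | zero => simp
  | add x y hx hy => simp only [map_add, hx, hy]
  | tmul v w => simp [mul_lact]

theorem lapp_left₂ (i : V →ₗ[k] Multiplier k A) (c d : A) (x : V ⊗[k] A) :
    lapp A i c (left₂ V d x) = left₂ A d (lapp A i c x) := by
  induction x using TensorProduct.induction_on with
  | zero => simp
  | add x y hx hy => simp only [map_add, hx, hy]
  | tmul v w => simp

theorem lapp_right₂ (i : V →ₗ[k] Multiplier k A) (c d : A) (x : V ⊗[k] A) :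
    lapp A i c (right₂ V d x) = right₂ A d (lapp A i c x) := by
  induction x using TensorProduct.induction_on with
  | zero => simp
  | add x y hx hy => simp only [map_add, hx, hy]
  | tmul v w => simp

theorem lapp_lTensor {W' : Type*} [AddCommGroup W'] [Module k W'] (i : V →ₗ[k] Multiplier k A)
    (c : A) (f : W →ₗ[k] W') (x : V ⊗[k] W) :
    lapp W' i c (f.lTensor V x) = f.lTensor A (lapp W i c x) := by
  induction x using TensorProduct.induction_on with
  | zero => simp
  | add x y hx hy => simp only [map_add, hx, hy]
  | tmul v w => simp

theorem lapp_rTensor {V' : Type*} [AddCommGroup V'] [Module k V'] (i : V →ₗ[k] Multiplier k A)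
    (c : A) (f : V' →ₗ[k] V) (x : V' ⊗[k] W) :
    lapp W i c (f.rTensor W x) = lapp W (i ∘ₗ f) c x := by
  induction x using TensorProduct.induction_on with
  | zero => simp
  | add x y hx hy => simp only [map_add, hx, hy]
  | tmul v w => simp

theorem rapp_rTensor {V' : Type*} [AddCommGroup V'] [Module k V'] (i : V →ₗ[k] Multiplier k A)
    (c : A) (f : V' →ₗ[k] V) (x : V' ⊗[k] W) :
    rapp W i c (f.rTensor W x) = rapp W (i ∘ₗ f) c x := by
  induction x using TensorProduct.induction_on with
  | zero => simp
  | add x y hx hy => simp only [map_add, hx, hy]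
  | tmul v w => simp

theorem mul_lTensor_lact (m : Multiplier k A) (w z : A ⊗[k] A) :
    w * (lact m).lTensor A z = (ract m).lTensor A w * z := by
  induction w using TensorProduct.induction_on with
  | zero => simp
  | add u v hu hv => simp only [map_add, add_mul, hu, hv]
  | tmul x y =>
    induction z using TensorProduct.induction_on with
    | zero => simp
    | add u v hu hv => simp only [map_add, mul_add, hu, hv]
    | tmul u v => simp [mul_lact]

theorem left₂_mul (a : A) (w z : A ⊗[k] A) : left₂ A a w * z = left₂ A a (w * z) := by
  induction w using TensorProduct.induction_on with
  | zero => simp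
  | add u v hu hv => simp only [map_add, add_mul, hu, hv]
  | tmul x y =>
    induction z using TensorProduct.induction_on with
    | zero => simp
    | add u v hu hv => simp only [map_add, mul_add, hu, hv]
    | tmul u v => simp [mul_assoc]

end Multipliers

/-! ### Maps acting on legs of triple tensor products, and slices by functionals. -/

section Legs

variable {k : Type*} [Field k]
variable {V W V' W' Z : Type*} [AddCommGroup V] [Module k V] [AddCommGroup W] [Module k W]
  [AddCommGroup V'] [Module k V'] [AddCommGroup W'] [Module k W'] [AddCommGroup Z] [Module k Z]

theorem assoc_tmul_eq_lTensor (x : V ⊗[k] W) (z : Z) :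
    TensorProduct.assoc k V W Z (x ⊗ₜ[k] z) = ((TensorProduct.mk k W Z).flip z).lTensor V x := by
  induction x using TensorProduct.induction_on with
  | zero => simp
  | add x y hx hy => simp only [TensorProduct.add_tmul, map_add, hx, hy]
  | tmul v w => simp

@[simp] theorem leg12_tmul (f : V ⊗[k] W →ₗ[k] V' ⊗[k] W') (v : V) (w : W) (z : Z) :
    leg12 Z f (v ⊗ₜ[k] (w ⊗ₜ[k] z)) =
      ((TensorProduct.mk k W' Z).flip z).lTensor V' (f (v ⊗ₜ[k] w)) := by
  rw [← assoc_tmul_eq_lTensor]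
  simp [leg12]

@[simp] theorem leg13_tmul (f : V ⊗[k] W →ₗ[k] V' ⊗[k] W') (v : V) (w : W) (z : Z) :
    leg13 Z f (v ⊗ₜ[k] (z ⊗ₜ[k] w)) = (TensorProduct.mk k Z W' z).lTensor V' (f (v ⊗ₜ[k] w)) := by
  simp only [leg13, LinearMap.comp_apply, LinearMap.lTensor_tmul, LinearEquiv.coe_coe,
    TensorProduct.comm_tmul, leg12_tmul]
  rw [← LinearMap.comp_apply, ← LinearMap.lTensor_comp]
  rfl

/-- `(V' ⊗ ω ⊗ Z) (f ⊗ Z)` evaluated at `v ⊗ x`. -/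
theorem lTensor_evalL_leg12 (f : V ⊗[k] W →ₗ[k] V' ⊗[k] W') (ω : W' →ₗ[k] k) (v : V)
    (x : W ⊗[k] Z) : (evalL Z ω).lTensor V' (leg12 Z f (v ⊗ₜ[k] x)) =
      (evalR V' ω ∘ₗ f ∘ₗ TensorProduct.mk k V W v).rTensor Z x := by
  induction x using TensorProduct.induction_on with
  | zero => simp
  | add x y hx hy => simp only [TensorProduct.tmul_add, map_add, hx, hy]
  | tmul w z =>
    simp only [leg12_tmul, LinearMap.rTensor_tmul, LinearMap.comp_apply, TensorProduct.mk_apply]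
    generalize f (v ⊗ₜ[k] w) = y
    induction y using TensorProduct.induction_on with
    | zero => simp
    | add x y hx hy => simp only [TensorProduct.add_tmul, map_add, hx, hy]
    | tmul s t => simp [TensorProduct.smul_tmul]

/-- `(V' ⊗ W' ⊗ ω) (f ⊗ Z)` evaluated at `v ⊗ x`. -/
theorem lTensor_evalR_leg12 (f : V ⊗[k] W →ₗ[k] V' ⊗[k] W') (ω : Z →ₗ[k] k) (v : V)
    (x : W ⊗[k] Z) : (evalR W' ω).lTensor V' (leg12 Z f (v ⊗ₜ[k] x)) =
      f (v ⊗ₜ[k] evalR W ω x) := by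
  induction x using TensorProduct.induction_on with
  | zero => simp
  | add x y hx hy => simp only [TensorProduct.tmul_add, map_add, hx, hy]
  | tmul w z =>
    simp only [leg12_tmul, evalR_tmul, TensorProduct.tmul_smul, map_smul]
    generalize f (v ⊗ₜ[k] w) = y
    induction y using TensorProduct.induction_on with
    | zero => simp
    | add x y hx hy => simp only [map_add, hx, hy, smul_add]
    | tmul s t => simp

theorem evalL_lTensor (ω : V →ₗ[k] k) (f : W →ₗ[k] W') (x : V ⊗[k] W) :
    evalL W' ω (f.lTensor V x) = f (evalL W ω x) := by
  induction x using TensorProduct.induction_on with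
  | zero => simp
  | add x y hx hy => simp only [map_add, hx, hy]
  | tmul v w => simp

theorem evalR_rTensor (ω : W →ₗ[k] k) (f : V →ₗ[k] V') (x : V ⊗[k] W) :
    evalR V' ω (f.rTensor W x) = f (evalR V ω x) := by
  induction x using TensorProduct.induction_on with
  | zero => simp
  | add x y hx hy => simp only [map_add, hx, hy]
  | tmul v w => simp

theorem evalR_lTensor (ω : W' →ₗ[k] k) (f : W →ₗ[k] W') (x : V ⊗[k] W) :
    evalR V ω (f.lTensor V x) = evalR V (ω ∘ₗ f) x := by
  induction x using TensorProduct.induction_on with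
  | zero => simp
  | add x y hx hy => simp only [map_add, hx, hy]
  | tmul v w => simp

theorem evalL_rTensor (ω : V' →ₗ[k] k) (f : V →ₗ[k] V') (x : V ⊗[k] W) :
    evalL W ω (f.rTensor W x) = evalL W (ω ∘ₗ f) x := by
  induction x using TensorProduct.induction_on with
  | zero => simp
  | add x y hx hy => simp only [map_add, hx, hy]
  | tmul v w => simp

end Legs

/-! ### Consequences of non-degeneracy and idempotence; `⊓̄ᴿ` as a leg of `E`. -/

section Bialgebra

variable {k : Type*} [Field k] {A : Type*} [NonUnitalRing A] [Module k A]
  [IsScalarTower k A A] [SMulCommClass k A A]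
  {V : Type*} [AddCommGroup V] [Module k V] {W : Type*} [AddCommGroup W] [Module k W]

namespace WeakMultiplierBialgebra

variable (B : WeakMultiplierBialgebra k A)

theorem cancel_mul_left (B : WeakMultiplierBialgebra k A)
    {x y : A ⊗[k] A} (h : ∀ z : A ⊗[k] A, z * x = z * y) :
    x = y :=
  B.cancel_left₂ fun b => B.cancel_left₁ fun a => by rw [← tmul_mul, ← tmul_mul, h]

theorem ext_lact (B : WeakMultiplierBialgebra k A)
    {m n : Multiplier k A} (h : ∀ a, lact m a = lact n a) :
    m = n :=
  multiplier_ext_lact (fun x y hxy => sub_eq_zero.1 (B.nondeg_right _ fun b => by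
    rw [sub_mul, hxy, sub_self])) h

theorem ext_ract (B : WeakMultiplierBialgebra k A)
    {m n : Multiplier k A} (h : ∀ a, ract m a = ract n a) :
    m = n :=
  multiplier_ext_ract (fun x y hxy => sub_eq_zero.1 (B.nondeg_left _ fun b => by
    rw [mul_sub, hxy, sub_self])) h

theorem ext_lact_tensor (B : WeakMultiplierBialgebra k A)
    {m n : Multiplier k (A ⊗[k] A)} (h : ∀ x, lact m x = lact n x) :
    m = n :=
  multiplier_ext_lact (fun _ _ hxy => B.cancel_mul fun a b => hxy (a ⊗ₜ b)) h

theorem ext_ract_tensor (B : WeakMultiplierBialgebra k A)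
    {m n : Multiplier k (A ⊗[k] A)} (h : ∀ x, ract m x = ract n x) :
    m = n :=
  multiplier_ext_ract (fun _ _ hxy => B.cancel_mul_left hxy) h

/-- Right `A`-linearity is not part of the definition of a multiplier: it follows by multiplying
with `c` from the left and moving `m` across. -/
theorem lact_mul_apply (B : WeakMultiplierBialgebra k A) (m : Multiplier k A) (a b : A) :
    lact m (a * b) = lact m a * b := by
  rw [← sub_eq_zero]
  refine B.nondeg_left _ fun c => ?_
  rw [mul_sub, mul_lact, ← mul_assoc, ← mul_assoc, mul_lact, sub_self]

theorem ract_mul_apply (B : WeakMultiplierBialgebra k A) (m : Multiplier k A) (a b : A) :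
    ract m (a * b) = a * ract m b := by
  rw [← sub_eq_zero]
  refine B.nondeg_right _ fun c => ?_
  rw [sub_mul, ← mul_lact, mul_assoc, mul_assoc, mul_lact, sub_self]

/-- Functionals on `W` separate the tensors, and the left action separates multipliers. Identities
in `R ⊗ A` can thus be checked after acting on an arbitrary `c` in `A`. -/
theorem lapp_injective (B : WeakMultiplierBialgebra k A)
    {i : V →ₗ[k] Multiplier k A} (hi : Function.Injective i)
    {x y : V ⊗[k] W} (h : ∀ c, lapp W i c x = lapp W i c y) : x = y := by
  rw [← sub_eq_zero]
  refine eq_zero_of_evalR _ fun ω => hi (B.ext_lact fun c => ?_)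
  rw [← evalR_lapp, map_sub, h, sub_self]
  simp

theorem rapp_injective (B : WeakMultiplierBialgebra k A)
    {i : V →ₗ[k] Multiplier k A} (hi : Function.Injective i)
    {x y : V ⊗[k] W} (h : ∀ c, rapp W i c x = rapp W i c y) : x = y := by
  rw [← sub_eq_zero]
  refine eq_zero_of_evalR _ fun ω => hi (B.ext_ract fun c => ?_)
  rw [← evalR_rapp, map_sub, h, sub_self]
  simp

/-- The substitute for a unit: by idempotence every element is a sum of products. -/
theorem mul_induction (B : WeakMultiplierBialgebra k A) {p : A → Prop} (hmul : ∀ a b, p (a * b))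
    (hadd : ∀ a b, p a → p b → p (a + b)) (a : A) : p a := by
  obtain ⟨x, rfl⟩ := B.idempotent a
  induction x using TensorProduct.induction_on with
  | zero => simpa using hmul 0 0
  | add x y hx hy => rw [map_add]; exact hadd _ _ hx hy
  | tmul a b => exact hmul a b

theorem E₂_left₂ (a : A) (w : A ⊗[k] A) : B.E₂ (left₂ A a w) = left₂ A a (B.E₂ w) := by
  refine B.cancel_mul fun u v => ?_
  rw [← mul_E₁, left₂_mul, left₂_mul, mul_E₁]

theorem E₁_right₂ (a : A) (w : A ⊗[k] A) : B.E₁ (right₂ A a w) = right₂ A a (B.E₁ w) := by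
  refine B.cancel_mul_left fun z => ?_
  have h : ∀ u v : A ⊗[k] A, u * right₂ A a v = right₂ A a (u * v) := by
    intro u v
    induction u using TensorProduct.induction_on with
    | zero => simp
    | add s t hs ht => simp only [map_add, add_mul, hs, ht]
    | tmul s t => rw [tmul_mul, tmul_mul, left₂_right₂, left₁_right₂]
  rw [mul_E₁, h, h, mul_E₁]

theorem lact_barPiR (a b : A) : lact (B.barPiR a) b = evalR A B.counit (B.E₁ (b ⊗ₜ[k] a)) := rfl

theorem ract_barPiR (a b : A) : ract (B.barPiR a) b = evalR A B.counit (B.T₁ (b ⊗ₜ[k] a)) := rfl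

/-- `E (1 ⊗ a b) = (⊓̄ᴿ ⊗ A) T₁(a ⊗ b)` -/
theorem lapp_barPiR_T₁ (x a b : A) :
    lapp A B.barPiR x (B.T₁ (a ⊗ₜ[k] b)) = B.E₁ (x ⊗ₜ[k] (a * b)) := by
  -- The counit on the middle leg of `E_T₁` turns `E₁` into the action of `⊓̄ᴿ` on one side and `T₁`
  -- into multiplication on the other.
  have h := congrArg ((evalL A B.counit).lTensor A)
    (LinearMap.congr_fun B.E_T₁ (x ⊗ₜ[k] (a ⊗ₜ[k] b)))
  simp only [LinearMap.comp_apply, LinearMap.lTensor_tmul, lTensor_evalL_leg12, leg12_tmul] at h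
  rw [← right₂_tmul, B.E₁_right₂]
  refine Eq.trans h ?_
  rw [← LinearMap.comp_apply, ← LinearMap.comp_apply, ← LinearMap.lTensor_comp,
    ← LinearMap.lTensor_comp]
  unfold right₂
  congr 2
  ext c
  simp [evalL_T₁]

/-- `Δ(q ⊓̄ᴿ(y)) = Δ(q) (1 ⊗ ⊓̄ᴿ(y))` -/
theorem T₂_ract_barPiR (x q y : A) : B.T₂ (x ⊗ₜ[k] ract (B.barPiR y) q) =
    (ract (B.barPiR y)).lTensor A (B.T₂ (x ⊗ₜ[k] q)) := by
  -- The counit goes on the last leg of coassociativity, where `(A ⊗ ϵ)T₁(- ⊗ y)` is right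
  -- multiplication by `⊓̄ᴿ(y)`.
  have h := congrArg ((evalR A B.counit).lTensor A)
    (LinearMap.congr_fun B.coassoc (x ⊗ₜ[k] (q ⊗ₜ[k] y)))
  simp only [LinearMap.comp_apply, LinearMap.lTensor_tmul, lTensor_evalR_leg12, leg12_tmul] at h
  refine Eq.trans h ?_
  rw [← LinearMap.comp_apply, ← LinearMap.comp_apply, ← LinearMap.lTensor_comp,
    ← LinearMap.lTensor_comp]
  rfl

theorem T₁_mul (a c b : A) : B.T₁ ((a * c) ⊗ₜ[k] b) = B.comulL a (B.T₁ (c ⊗ₜ[k] b)) := by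
  refine B.cancel_right₁ fun x => ?_
  rw [← comulL_tmul, comulL_mul, comulL_tmul]
  generalize B.T₁ (c ⊗ₜ[k] b) = w
  induction w using TensorProduct.induction_on with
  | zero => simp
  | add u v hu hv => simp only [map_add, hu, hv]
  | tmul u v =>
    simp only [right₁_tmul, comulL_tmul]
    generalize B.T₁ (a ⊗ₜ[k] v) = w
    induction w using TensorProduct.induction_on with
    | zero => simp
    | add u v hu hv => simp only [map_add, hu, hv]
    | tmul u v => simp [mul_assoc]

/-- `E₁_comulL` does not apply directly, since `1 ⊗ b` is not in `A ⊗ A`. For a product `a c` in the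
first argument, `T₁` becomes `Δ(a)` applied to an element of `A ⊗ A`. -/
theorem E₁_T₁ (w : A ⊗[k] A) : B.E₁ (B.T₁ w) = B.T₁ w := by
  induction w using TensorProduct.induction_on with
  | zero => simp
  | add u v hu hv => simp only [map_add, hu, hv]
  | tmul a b =>
    refine B.mul_induction (p := fun a => B.E₁ (B.T₁ (a ⊗ₜ b)) = B.T₁ (a ⊗ₜ b)) ?_ ?_ a
    · intro a c
      rw [T₁_mul, E₁_comulL]
    · intro a c ha hc
      simp only [TensorProduct.add_tmul, map_add, ha, hc]

/-- Every vector space `S` containing `(V ⊗ ω) ((1 ⊗ c) x)` for all `c` and `ω` contains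
`(V ⊗ ω) x` for all `ω`. -/
theorem evalR_mem_of_left₂ (B : WeakMultiplierBialgebra k A) (S : Submodule k V) (x : V ⊗[k] A)
    (h : ∀ (c : A) (ω : A →ₗ[k] k), evalR V ω (left₂ V c x) ∈ S) (ω : A →ₗ[k] k) :
    evalR V ω x ∈ S := by
  -- Modulo `S` membership becomes vanishing, and the factor `c` is cancelled in `(V ⧸ S) ⊗ A`.
  have h0 : S.mkQ.rTensor A x = 0 := B.cancel_left₂ fun c => by
    rw [map_zero]
    refine eq_zero_of_evalR _ fun ω => ?_
    have h1 : left₂ (V ⧸ S) c (S.mkQ.rTensor A x) = S.mkQ.rTensor A (left₂ V c x) := by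
      generalize x = x
      induction x using TensorProduct.induction_on with
      | zero => simp
      | add u v hu hv => simp only [map_add, hu, hv]
      | tmul u v => simp
    rw [h1, evalR_rTensor]
    simpa using h c ω
  rw [← Submodule.Quotient.mk_eq_zero, ← Submodule.mkQ_apply, ← evalR_rTensor, h0, map_zero]

theorem evalR_mem_of_right₂ (B : WeakMultiplierBialgebra k A) (S : Submodule k V) (x : V ⊗[k] A)
    (h : ∀ (c : A) (ω : A →ₗ[k] k), evalR V ω (right₂ V c x) ∈ S) (ω : A →ₗ[k] k) :
    evalR V ω x ∈ S := by
  have h0 : S.mkQ.rTensor A x = 0 := B.cancel_right₂ fun c => by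
    rw [map_zero]
    refine eq_zero_of_evalR _ fun ω => ?_
    have h1 : right₂ (V ⧸ S) c (S.mkQ.rTensor A x) = S.mkQ.rTensor A (right₂ V c x) := by
      generalize x = x
      induction x using TensorProduct.induction_on with
      | zero => simp
      | add u v hu hv => simp only [map_add, hu, hv]
      | tmul u v => simp
    rw [h1, evalR_rTensor]
    simpa using h c ω
  rw [← Submodule.Quotient.mk_eq_zero, ← Submodule.mkQ_apply, ← evalR_rTensor, h0, map_zero]

end WeakMultiplierBialgebra

end Bialgebra

/-! ### The two descriptions of `R`, and how `R` commutes with `Δ` and `E`. -/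

section Base

set_option linter.unusedSectionVars false

variable {k : Type*} [Field k] {A : Type*} [NonUnitalRing A] [Module k A]
  [IsScalarTower k A A] [SMulCommClass k A A]
  {V : Type*} [AddCommGroup V] [Module k V] {W : Type*} [AddCommGroup W] [Module k W]

theorem add_left₂ (a b : A) : left₂ (k := k) V (a + b) = left₂ V a + left₂ V b := by
  rw [left₂, left₂, left₂, ← LinearMap.lTensor_add]
  congr 1
  ext c
  simp [add_mul]

theorem add_right₂ (a b : A) : right₂ (k := k) V (a + b) = right₂ V a + right₂ V b := by
  rw [right₂, right₂, right₂, ← LinearMap.lTensor_add]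
  congr 1
  ext c
  simp [mul_add]

theorem lTensor_left₁ (f : V →ₗ[k] W) (b : A) (w : A ⊗[k] V) :
    f.lTensor A (left₁ V b w) = left₁ W b (f.lTensor A w) := by
  induction w using TensorProduct.induction_on with
  | zero => simp
  | add u v hu hv => simp only [map_add, hu, hv]
  | tmul u v => simp

theorem lTensor_right₁ (f : V →ₗ[k] W) (b : A) (w : A ⊗[k] V) :
    f.lTensor A (right₁ V b w) = right₁ W b (f.lTensor A w) := by
  induction w using TensorProduct.induction_on with
  | zero => simp
  | add u v hu hv => simp only [map_add, hu, hv]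
  | tmul u v => simp

namespace RegularWeakMultiplierBialgebra

variable (B : RegularWeakMultiplierBialgebra k A)

theorem lact_piR (a b : A) : lact (B.piR a) b = evalR A B.counit (B.T₃ (b ⊗ₜ[k] a)) := rfl

theorem ract_piR (a b : A) : ract (B.piR a) b = evalR A B.counit (B.E₂ (b ⊗ₜ[k] a)) := rfl

theorem evalL_T₃ (a b : A) : evalL A B.counit (B.T₃ (a ⊗ₜ[k] b)) = b * a := by
  rw [← sub_eq_zero]
  refine B.nondeg_right _ fun d => ?_
  rw [sub_mul, ← evalL_right₂, ← B.regular_T₃, evalL_left₂, B.evalL_T₁, mul_assoc, sub_self]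

/-- Multiplying the first leg by `x` from the left turns `T₃(q ⊗ y)` into `(x ⊗ y)Δ(q)`, which `E₂`
fixes. -/
theorem E₂_T₃ (w : A ⊗[k] A) : B.E₂ (B.T₃ w) = B.T₃ w := by
  refine B.cancel_mul fun u v => ?_
  rw [← B.mul_E₁]
  refine LinearMap.congr_fun (f := LinearMap.mulRight k (B.E₁ (u ⊗ₜ[k] v)) ∘ₗ B.T₃)
    (g := LinearMap.mulRight k (u ⊗ₜ[k] v) ∘ₗ B.T₃) (TensorProduct.ext' fun q y => ?_) w
  refine B.cancel_left₁ fun x => ?_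
  have h : ∀ w z : A ⊗[k] A, left₁ A x (w * z) = left₁ A x w * z := by
    intro w z
    induction z using TensorProduct.induction_on with
    | zero => simp
    | add s t hs ht => simp only [map_add, mul_add, hs, ht]
    | tmul s t => rw [mul_tmul, mul_tmul, left₁_right₁, left₁_right₂]
  simp only [LinearMap.comp_apply, LinearMap.mulRight_apply]
  rw [h, h, left₁_T₃, ← B.comulR_tmul, B.mul_E₁, B.E₂_comulR]

/-- `(E₂ ⊗ A) (A ⊗ T₃) = (A ⊗ T₃) (E₂ ⊗ A)` -/
theorem E_T₃ (x a b : A) : leg12 A B.E₂ (x ⊗ₜ[k] B.T₃ (a ⊗ₜ[k] b)) =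
    B.T₃.lTensor A (leg12 A B.E₂ (x ⊗ₜ[k] (a ⊗ₜ[k] b))) := by
  rw [← sub_eq_zero]
  -- Multiply the middle leg by `y` from the left: `(y ⊗ 1)T₃(a ⊗ b) = (1 ⊗ b)T₂(y ⊗ a)` reduces the
  -- claim to the axiom `E_T₂`.
  refine eq_zero_of_evalL _ fun ω => B.cancel_left₁ fun y => ?_
  rw [map_zero, ← evalL_lTensor, map_sub, map_sub, sub_eq_zero]
  congr 1
  have h1 : ∀ z : A ⊗[k] A, (left₁ A y).lTensor A (leg12 A B.E₂ (x ⊗ₜ[k] z)) =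
      leg12 A B.E₂ (x ⊗ₜ[k] left₁ A y z) := by
    intro z
    induction z using TensorProduct.induction_on with
    | zero => simp
    | add u v hu hv => simp only [map_add, TensorProduct.tmul_add, hu, hv]
    | tmul u v =>
      rw [left₁_tmul, leg12_tmul, leg12_tmul, ← left₂_tmul y u x, B.E₂_left₂]
      unfold left₂
      rw [← LinearMap.lTensor_comp_apply, ← LinearMap.lTensor_comp_apply]
      rfl
  have h2 : ∀ z : A ⊗[k] A, (left₂ A b).lTensor A (leg12 A B.E₂ (x ⊗ₜ[k] z)) =
      leg12 A B.E₂ (x ⊗ₜ[k] left₂ A b z) := by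
    intro z
    induction z using TensorProduct.induction_on with
    | zero => simp
    | add u v hu hv => simp only [map_add, TensorProduct.tmul_add, hu, hv]
    | tmul u v =>
      rw [left₂_tmul, leg12_tmul, leg12_tmul, ← LinearMap.lTensor_comp_apply]
      rfl
  have h3 := LinearMap.congr_fun B.E_T₂ (x ⊗ₜ[k] (y ⊗ₜ[k] a))
  simp only [LinearMap.comp_apply, LinearMap.lTensor_tmul, leg13_tmul] at h3
  rw [h1, left₁_T₃, ← h2, h3, leg12_tmul]
  simp only [← LinearMap.lTensor_comp_apply]
  congr 2
  refine LinearMap.ext fun c => ?_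
  simp [left₁_T₃]

/-- `(1 ⊗ b a) E = (⊓ᴿ ⊗ A) T₃(a ⊗ b)` -/
theorem rapp_piR_T₃ (x a b : A) :
    rapp A B.piR x (B.T₃ (a ⊗ₜ[k] b)) = B.E₂ (x ⊗ₜ[k] (b * a)) := by
  have h := congrArg ((evalL A B.counit).lTensor A) (B.E_T₃ x a b)
  simp only [lTensor_evalL_leg12, leg12_tmul] at h
  rw [← left₂_tmul, B.E₂_left₂]
  refine Eq.trans h ?_
  simp only [← LinearMap.lTensor_comp_apply]
  unfold left₂
  congr 2
  refine LinearMap.ext fun c => ?_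
  simp [evalL_T₃]

/-- `Δ(⊓ᴿ(y) q) = (1 ⊗ ⊓ᴿ(y)) Δ(q)` -/
theorem T₂_lact_piR (x q y : A) : B.T₂ (x ⊗ₜ[k] lact (B.piR y) q) =
    (lact (B.piR y)).lTensor A (B.T₂ (x ⊗ₜ[k] q)) := by
  have h := congrArg ((evalR A B.counit).lTensor A) (B.coassoc_T₃ x q y)
  simp only [lTensor_evalR_leg12, leg12_tmul] at h
  refine Eq.trans h ?_
  simp only [← LinearMap.lTensor_comp_apply]
  rfl

/-- Two computations of `(1 ⊗ cd)E(1 ⊗ ab)`: expand `E(1 ⊗ ab)` by `⊓̄ᴿ`, or `(1 ⊗ cd)E` by `⊓ᴿ`. -/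
theorem left₂_barPiR_T₁ (a b c d : A) :
    left₂ _ (c * d) (B.barPiR.rTensor A (B.T₁ (a ⊗ₜ[k] b))) =
      right₂ _ (a * b) (B.piR.rTensor A (B.T₃ (d ⊗ₜ[k] c))) := by
  refine B.lapp_injective (i := LinearMap.id) Function.injective_id fun x => ?_
  rw [lapp_left₂, lapp_right₂, lapp_rTensor, lapp_rTensor, LinearMap.id_comp, LinearMap.id_comp,
    B.lapp_barPiR_T₁]
  refine B.cancel_left₁ fun y => ?_
  rw [← tmul_mul, B.mul_E₁, mul_tmul, left₁_right₂, left₁_lapp, rapp_piR_T₃, right_comm]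

/-- By `(1 ⊗ c)T₁(a ⊗ b) = T₃(a ⊗ c)(1 ⊗ b)`, slices of `T₁` become slices of `T₃` after
multiplication by `c`, and `evalR_mem_of_left₂` removes `c`. -/
theorem span_evalR_T₃ (hB : B.RightFull) : Submodule.span k
    {x : A | ∃ (a b : A) (ω : A →ₗ[k] k), x = evalR A ω (B.T₃ (a ⊗ₜ[k] b))} = ⊤ := by
  rw [← top_le_iff, ← hB, Submodule.span_le]
  rintro x ⟨a, b, ω, rfl⟩
  refine B.evalR_mem_of_left₂ _ _ (fun c ω => ?_) ω
  rw [B.regular_T₃, right₂, evalR_lTensor]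
  exact Submodule.subset_span ⟨_, _, _, rfl⟩

/-- If the comultiplication is right full, then `⊓̄ᴿ` and `⊓ᴿ` have the same range. -/
theorem range_barPiR (hB : B.RightFull) : LinearMap.range B.barPiR = B.base := by
  apply le_antisymm
  · rw [LinearMap.range_eq_map, ← hB, Submodule.map_span_le]
    rintro x ⟨a, b, ω, rfl⟩
    rw [← evalR_rTensor]
    -- After multiplication by a product `c d` the first leg lies in the range of `⊓ᴿ`, by
    -- `left₂_barPiR_T₁`.
    refine B.evalR_mem_of_left₂ _ _ (fun c ω => ?_) ω
    induction c using B.mul_induction with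
    | hmul c d =>
      rw [left₂_barPiR_T₁, right₂, evalR_lTensor, evalR_rTensor]
      exact ⟨_, rfl⟩
    | hadd c d hc hd =>
      rw [add_left₂, LinearMap.add_apply, map_add]
      exact add_mem hc hd
  · rw [base, LinearMap.range_eq_map, ← B.span_evalR_T₃ hB, Submodule.map_span_le]
    rintro x ⟨a, b, ω, rfl⟩
    rw [← evalR_rTensor]
    refine B.evalR_mem_of_right₂ _ _ (fun c ω => ?_) ω
    induction c using B.mul_induction with
    | hmul c d =>
      rw [← left₂_barPiR_T₁, left₂, evalR_lTensor, evalR_rTensor]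
      exact ⟨_, rfl⟩
    | hadd c d hc hd =>
      rw [add_right₂, LinearMap.add_apply, map_add]
      exact add_mem hc hd

/-- `Δ(m q) = (1 ⊗ m) Δ(q)` for `m ∈ R` -/
theorem T₂_lact_base {m : Multiplier k A} (hm : m ∈ B.base) (x q : A) : B.T₂ (x ⊗ₜ[k] lact m q) =
    (lact m).lTensor A (B.T₂ (x ⊗ₜ[k] q)) := by
  obtain ⟨y, rfl⟩ := hm
  exact B.T₂_lact_piR x q y

/-- `Δ(q m) = Δ(q) (1 ⊗ m)` for `m ∈ R` -/
theorem T₂_ract_base (hB : B.RightFull) {m : Multiplier k A} (hm : m ∈ B.base) (x q : A) :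
    B.T₂ (x ⊗ₜ[k] ract m q) =
      (ract m).lTensor A (B.T₂ (x ⊗ₜ[k] q)) := by
  obtain ⟨y, rfl⟩ := (B.range_barPiR hB).ge hm
  exact B.T₂_ract_barPiR x q y

theorem lTensor_lact_right₂ (B : RegularWeakMultiplierBialgebra k A)
    (m : Multiplier k A) (b : A) (w : V ⊗[k] A) :
    (lact m).lTensor V (right₂ V b w) = right₂ V b ((lact m).lTensor V w) := by
  unfold right₂
  simp only [← LinearMap.lTensor_comp_apply]
  congr 2
  refine LinearMap.ext fun c => ?_
  simp [B.lact_mul_apply]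

theorem lTensor_ract_left₂ (B : RegularWeakMultiplierBialgebra k A)
    (m : Multiplier k A) (b : A) (w : V ⊗[k] A) :
    (ract m).lTensor V (left₂ V b w) = left₂ V b ((ract m).lTensor V w) := by
  unfold left₂
  simp only [← LinearMap.lTensor_comp_apply]
  congr 2
  refine LinearMap.ext fun c => ?_
  simp [B.ract_mul_apply]

theorem T₁_lact_base {m : Multiplier k A} (hm : m ∈ B.base) (a b : A) : B.T₁ (lact m a ⊗ₜ[k] b) =
    (lact m).lTensor A (B.T₁ (a ⊗ₜ[k] b)) := by
  refine B.cancel_left₁ fun x => ?_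
  rw [B.left₁_T₁, B.T₂_lact_base hm, ← lTensor_left₁, B.left₁_T₁, B.lTensor_lact_right₂]

theorem comulL_lact_base {m : Multiplier k A} (hm : m ∈ B.base) (a : A) (z : A ⊗[k] A) :
    (lact m).lTensor A (B.comulL a z) =
      B.comulL (lact m a) z := by
  induction z using TensorProduct.induction_on with
  | zero => simp
  | add u v hu hv => simp only [map_add, hu, hv]
  | tmul x y => rw [B.comulL_tmul, B.comulL_tmul, B.T₁_lact_base hm, lTensor_right₁]

theorem comulR_ract_base (hB : B.RightFull) {m : Multiplier k A} (hm : m ∈ B.base)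
    (a : A) (z : A ⊗[k] A) : (ract m).lTensor A (B.comulR a z) =
      B.comulR (ract m a) z := by
  induction z using TensorProduct.induction_on with
  | zero => simp
  | add u v hu hv => simp only [map_add, hu, hv]
  | tmul x y => rw [B.comulR_tmul, B.comulR_tmul, B.T₂_ract_base hB hm, B.lTensor_ract_left₂]

/-- Every statement about `E₁ z`, closed under linear combinations, follows from the statement
about the elements `Δ(a) z`. -/
theorem E₁_induction {p : A ⊗[k] A → Prop} (h0 : p 0) (hadd : ∀ x y, p x → p y → p (x + y))
    (hsmul : ∀ (c : k) x, p x → p (c • x)) (h : ∀ a b c, p (right₁ A b (B.T₁ (a ⊗ₜ c))))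
    (z : A ⊗[k] A) : p (B.E₁ z) := by
  have hz : B.E₁ z ∈ Submodule.span k {x | ∃ b c : A, x = B.E₁ (b ⊗ₜ[k] c)} := by
    induction z using TensorProduct.induction_on with
    | zero => simp
    | add u v hu hv => rw [map_add]; exact add_mem hu hv
    | tmul b c => exact Submodule.subset_span ⟨b, c, rfl⟩
  generalize B.E₁ z = w at hz ⊢
  rw [← B.span_E₁] at hz
  induction hz using Submodule.span_induction with
  | mem x hx => obtain ⟨a, b, c, rfl⟩ := hx; exact h a b c
  | zero => exact h0
  | add x y _ _ hx hy => exact hadd x y hx hy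
  | smul r x _ hx => exact hsmul r x hx

theorem E₂_induction {p : A ⊗[k] A → Prop} (h0 : p 0) (hadd : ∀ x y, p x → p y → p (x + y))
    (hsmul : ∀ (c : k) x, p x → p (c • x)) (h : ∀ a b c, p (left₂ A c (B.T₂ (b ⊗ₜ a))))
    (z : A ⊗[k] A) : p (B.E₂ z) := by
  have hz : B.E₂ z ∈ Submodule.span k {x | ∃ b c : A, x = B.E₂ (b ⊗ₜ[k] c)} := by
    induction z using TensorProduct.induction_on with
    | zero => simp
    | add u v hu hv => rw [map_add]; exact add_mem hu hv
    | tmul b c => exact Submodule.subset_span ⟨b, c, rfl⟩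
  generalize B.E₂ z = w at hz ⊢
  rw [← B.span_E₂] at hz
  induction hz using Submodule.span_induction with
  | mem x hx => obtain ⟨a, b, c, rfl⟩ := hx; exact h a b c
  | zero => exact h0
  | add x y _ _ hx hy => exact hadd x y hx hy
  | smul r x _ hx => exact hsmul r x hx

/-- `E (1 ⊗ m) E = (1 ⊗ m) E` for `m ∈ R` -/
theorem E₁_lact_E₁ {m : Multiplier k A} (hm : m ∈ B.base) (z : A ⊗[k] A) :
    B.E₁ ((lact m).lTensor A (B.E₁ z)) =
      (lact m).lTensor A (B.E₁ z) := by
  refine B.E₁_induction (p := fun w => B.E₁ ((lact m).lTensor A w) =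
    (lact m).lTensor A w) (by simp) (fun x y hx hy => ?_)
    (fun c x hx => ?_) (fun a b c => ?_) z
  · rw [map_add, map_add, hx, hy]
  · rw [map_smul, map_smul, hx]
  · rw [← B.comulL_tmul, B.comulL_lact_base hm, B.E₁_comulL]

/-- `E (1 ⊗ m) = (1 ⊗ m) E` for `m ∈ R` -/
theorem E₁_lact_base (hB : B.RightFull) {m : Multiplier k A} (hm : m ∈ B.base) (z : A ⊗[k] A) :
    B.E₁ ((lact m).lTensor A z) =
      (lact m).lTensor A (B.E₁ z) := by
  -- The mirror statement `E(1 ⊗ m)E = E(1 ⊗ m)`, from `Δ(q)(1 ⊗ m) = Δ(qm)`. It needs `m` in the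
  -- form `⊓̄ᴿ(y)`, which is where right fullness enters.
  have h : ∀ w : A ⊗[k] A, B.E₂ ((ract m).lTensor A (B.E₂ w)) =
      (ract m).lTensor A (B.E₂ w) := by
    refine B.E₂_induction (p := fun w => B.E₂ ((ract m).lTensor A w) =
      (ract m).lTensor A w) (by simp) (fun x y hx hy => ?_)
      (fun c x hx => ?_) (fun a b c => ?_)
    · rw [map_add, map_add, hx, hy]
    · rw [map_smul, map_smul, hx]
    · rw [← B.comulR_tmul, B.comulR_ract_base hB hm, B.E₂_comulR]
  rw [← B.E₁_lact_E₁ hm]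
  refine B.cancel_mul_left fun w => ?_
  rw [B.mul_E₁, B.mul_E₁, mul_lTensor_lact, mul_lTensor_lact, B.mul_E₁, h]

end RegularWeakMultiplierBialgebra

end Base

/-! ### Factorization of linear maps; the counit of `R`. -/

section CounitAndF

set_option linter.unusedSectionVars false

variable {k : Type*} [Field k] {A : Type*} [NonUnitalRing A] [Module k A]
  [IsScalarTower k A A] [SMulCommClass k A A]
  {V : Type*} [AddCommGroup V] [Module k V] {W : Type*} [AddCommGroup W] [Module k W]

theorem rapp_lTensor {W' : Type*} [AddCommGroup W'] [Module k W'] (i : V →ₗ[k] Multiplier k A)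
    (c : A) (f : W →ₗ[k] W') (x : V ⊗[k] W) :
    rapp W' i c (f.lTensor V x) = f.lTensor A (rapp W i c x) := by
  induction x using TensorProduct.induction_on with
  | zero => simp
  | add x y hx hy => simp only [map_add, hx, hy]
  | tmul v w => simp

theorem evalR_evalL (ω : V →ₗ[k] k) (φ : W →ₗ[k] k) (x : V ⊗[k] W) :
    φ (evalL W ω x) = ω (evalR V φ x) := by
  induction x using TensorProduct.induction_on with
  | zero => simp
  | add x y hx hy => simp only [map_add, hx, hy]
  | tmul v w => simp [mul_comm]

theorem evalR_left₂_eq_zero {ω : A →ₗ[k] k} {a : A} (h : ∀ b, ω (a * b) = 0) (x : V ⊗[k] A) :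
    evalR V ω (left₂ V a x) = 0 := by
  induction x using TensorProduct.induction_on with
  | zero => simp
  | add x y hx hy => simp only [map_add, hx, hy, add_zero]
  | tmul v w => simp [h]

theorem evalL_left₁_eq_zero {ω : A →ₗ[k] k} {a : A} (h : ∀ b, ω (a * b) = 0) (x : A ⊗[k] V) :
    evalL V ω (left₁ V a x) = 0 := by
  induction x using TensorProduct.induction_on with
  | zero => simp
  | add x y hx hy => simp only [map_add, hx, hy, add_zero]
  | tmul v w => simp [h]

theorem exists_linear_section {f : V →ₗ[k] W} (hf : Function.Surjective f) :
    ∃ s : W →ₗ[k] V, ∀ x, f (s x) = x := by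
  obtain ⟨s, hs⟩ := f.exists_rightInverse_of_surjective (LinearMap.range_eq_top.2 hf)
  exact ⟨s, LinearMap.congr_fun hs⟩

/-- A linear map vanishing on the kernel of a surjective linear map factors through it. -/
theorem exists_comp_eq_of_surjective {f : V →ₗ[k] W} (hf : Function.Surjective f)
    {Z : Type*} [AddCommGroup Z] [Module k Z] {g : V →ₗ[k] Z} (h : ∀ x, f x = 0 → g x = 0) :
    ∃ l : W →ₗ[k] Z, l ∘ₗ f = g := by
  obtain ⟨s, hs⟩ := exists_linear_section hf
  refine ⟨g ∘ₗ s, LinearMap.ext fun x => ?_⟩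
  rw [LinearMap.comp_apply, LinearMap.comp_apply, ← sub_eq_zero, ← map_sub]
  apply h
  rw [map_sub, hs, sub_self]

/-- A linear map into the range of an injective linear map factors through it. -/
theorem exists_comp_eq_of_injective {Z : Type*} [AddCommGroup Z] [Module k Z] {f : W →ₗ[k] Z}
    (hf : Function.Injective f) {g : V →ₗ[k] Z} (h : ∀ x, ∃ y, f y = g x) :
    ∃ l : V →ₗ[k] W, f ∘ₗ l = g := by
  refine ⟨(LinearEquiv.ofInjective f hf).symm.toLinearMap ∘ₗ
    g.codRestrict (LinearMap.range f) h, LinearMap.ext fun x => ?_⟩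
  have h := congrArg Subtype.val ((LinearEquiv.ofInjective f hf).apply_symm_apply
    (g.codRestrict (LinearMap.range f) h x))
  exact h

/-- An identification of the vector space `R` with the base `⊓ᴿ(A)`: an injection of `R` into the
multiplier algebra and a surjection of `A` onto `R` whose composite is `⊓ᴿ`. -/
structure BaseModel (B : RegularWeakMultiplierBialgebra k A) (R : Type*) [AddCommGroup R]
    [Module k R] where
  incl : R →ₗ[k] Multiplier k A
  proj : A →ₗ[k] R
  incl_injective : Function.Injective incl
  proj_surjective : Function.Surjective proj
  incl_comp_proj : incl ∘ₗ proj = B.piR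

namespace BaseModel

variable {B : RegularWeakMultiplierBialgebra k A} {R : Type*} [AddCommGroup R] [Module k R]
  (M : BaseModel B R)

theorem incl_proj (a : A) : M.incl (M.proj a) = B.piR a := LinearMap.congr_fun M.incl_comp_proj a

theorem incl_mem (r : R) : M.incl r ∈ B.base := by
  obtain ⟨a, rfl⟩ := M.proj_surjective r
  exact ⟨a, (M.incl_proj a).symm⟩

theorem exists_incl_eq {m : Multiplier k A} (hm : m ∈ B.base) : ∃ r, M.incl r = m := by
  obtain ⟨a, rfl⟩ := hm
  exact ⟨_, M.incl_proj a⟩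

theorem proj_eq_zero_iff (a : A) : M.proj a = 0 ↔ B.piR a = 0 := by
  rw [← M.incl_proj, map_eq_zero_iff M.incl M.incl_injective]

end BaseModel

namespace RegularWeakMultiplierBialgebra

variable (B : RegularWeakMultiplierBialgebra k A) {R : Type*} [AddCommGroup R] [Module k R]
  (M : BaseModel B R)

theorem counit_lact_piR (a b : A) : B.counit (lact (B.piR a) b) = B.counit (a * b) := by
  rw [lact_piR, ← B.counit_evalL, evalL_T₃]

/-- The kernel of `⊓ᴿ` is the radical of the form `ϵ(ab)` in its first variable: `x (⊓ᴿ(a) b) = (A ⊗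
ϵ)((1 ⊗ a)T₂(x ⊗ b))` depends on `a` only through the values `ϵ(a -)`. -/
theorem piR_eq_zero_iff (a : A) : B.piR a = 0 ↔ ∀ b, B.counit (a * b) = 0 := by
  refine ⟨fun h b => ?_, fun h => B.ext_lact fun b => ?_⟩
  · rw [← counit_lact_piR, h]
    simp
  · rw [← sub_eq_zero]
    refine B.nondeg_left _ fun x => ?_
    rw [map_zero, LinearMap.zero_apply, sub_zero, lact_piR, ← evalR_left₁, left₁_T₃,
      evalR_left₂_eq_zero h]

/-- Multiplied by `d ⊗ c` on the right, `(x ⊗ a)E` becomes `x ⊗ a` times an element of `A ⊗ A`, so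
`ϵ` on its second leg sees only the values `ϵ(a -)`. -/
theorem lTensor_proj_E₂ {a : A} (h : B.piR a = 0) (x : A) :
    M.proj.lTensor A (B.E₂ (x ⊗ₜ[k] a)) = 0 := by
  rw [piR_eq_zero_iff] at h
  refine eq_zero_of_evalL _ fun ω => ?_
  rw [evalL_lTensor, M.proj_eq_zero_iff, piR_eq_zero_iff]
  intro c
  rw [← evalL_right₂, evalR_evalL]
  convert map_zero ω
  refine B.nondeg_right _ fun d => ?_
  rw [← evalR_right₁, ← mul_tmul, ← B.mul_E₁, tmul_mul, evalR_left₁, evalR_left₂_eq_zero h,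
    mul_zero]

/-- The axiom `counit_E₂` trades `E₂` for `T₂`, and `ϵ` on the first leg of `(p ⊗ 1)Δ(y)(1 ⊗ w)`
sees only the values `ϵ(p -)`. -/
theorem evalL_E₂_eq_zero {p : A} (h : B.piR p = 0) (v : A) :
    evalL A B.counit (B.E₂ (p ⊗ₜ[k] v)) = 0 := by
  rw [piR_eq_zero_iff] at h
  refine B.nondeg_right _ fun y => ?_
  rw [← evalL_right₂, B.counit_E₂, evalL_left₂]
  convert mul_zero v
  refine B.nondeg_right _ fun w => ?_
  rw [← evalL_right₂, ← B.left₁_T₁, evalL_left₁_eq_zero h]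

theorem rapp_piR_T₃_apply (x : A) (z : A ⊗[k] A) : rapp A B.piR x (B.T₃ z) =
    B.E₂ (x ⊗ₜ[k] LinearMap.mul' k A (TensorProduct.comm k A A z)) := by
  induction z using TensorProduct.induction_on with
  | zero => simp
  | add u v hu hv => simp only [map_add, TensorProduct.tmul_add, hu, hv]
  | tmul u v => simp [rapp_piR_T₃]

/-- Without a unit, `ϵ(ab) = 0` for all `b` does not give `ϵ(a) = 0` at once. Let `a` be the
opposite product of `z`. Then `ϵ(a) = (ϵ ⊗ ϵ)(T₃ z) = β(T₃ z)` with `β = (ϵ ⊗ ϵ)E₂`, because `E₂`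
fixes `T₃ z`. The form `β` vanishes when either argument is in the kernel of `⊓ᴿ`, and the image of
`T₃ z` in `R ⊗ R` is that of `(1 ⊗ a)E`, which is zero. -/
theorem counit_eq_zero (M : BaseModel B R) {a : A} (h : B.piR a = 0) : B.counit a = 0 := by
  obtain ⟨z', hz'⟩ := B.idempotent a
  obtain ⟨z, rfl⟩ := (TensorProduct.comm k A A).surjective z'
  -- The section makes the factorization of `β` through `R ⊗ R` explicit: `p` and `s (proj p)`
  -- differ by an element of the kernel of `⊓ᴿ`.
  obtain ⟨s, hs⟩ := exists_linear_section M.proj_surjective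
  have hs : ∀ p, B.piR (p - s (M.proj p)) = 0 := fun p => by
    rw [map_sub, sub_eq_zero, ← M.incl_proj, ← M.incl_proj, hs]
  let β : A ⊗[k] A →ₗ[k] k := B.counit ∘ₗ evalL A B.counit ∘ₗ B.E₂
  have hβl : ∀ p v, B.piR p = 0 → β (p ⊗ₜ v) = 0 := fun p v hp => by
    simp [β, B.evalL_E₂_eq_zero hp]
  have hβr : ∀ p v, B.piR v = 0 → β (p ⊗ₜ v) = 0 := fun p v hv => by
    simp only [β, LinearMap.comp_apply]
    rw [B.counit_evalL, ← ract_piR, hv]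
    simp
  have hβ : ∀ w, β w = β (TensorProduct.map s s (TensorProduct.map M.proj M.proj w)) := by
    intro w
    induction w using TensorProduct.induction_on with
    | zero => simp
    | add u v hu hv => simp only [map_add, ← hu, ← hv]
    | tmul p v =>
      rw [TensorProduct.map_tmul, TensorProduct.map_tmul]
      have h1 := hβl _ v (hs p)
      have h2 := hβr (s (M.proj p)) _ (hs v)
      rw [TensorProduct.sub_tmul, map_sub, sub_eq_zero] at h1
      rw [TensorProduct.tmul_sub, map_sub, sub_eq_zero] at h2
      rw [h1, h2]
  have h0 : TensorProduct.map M.proj M.proj (B.T₃ z) = 0 := by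
    rw [← LinearMap.lTensor_comp_rTensor]
    refine B.rapp_injective M.incl_injective fun x => ?_
    rw [LinearMap.comp_apply, rapp_lTensor, rapp_rTensor, M.incl_comp_proj, rapp_piR_T₃_apply,
      hz', B.lTensor_proj_E₂ M h, map_zero]
  have h1 : ∀ z, evalL A B.counit (B.T₃ z) = LinearMap.mul' k A (TensorProduct.comm k A A z) := by
    intro z
    induction z using TensorProduct.induction_on with
    | zero => simp
    | add u v hu hv => simp only [map_add, hu, hv]
    | tmul u v => simp [evalL_T₃]
  have h2 := hβ (B.T₃ z)
  rw [h0, map_zero, map_zero] at h2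
  rw [← hz', ← h1, ← E₂_T₃]
  exact h2

theorem existsUnique_baseCounit (M : BaseModel B R) :
    ∃! ε : R →ₗ[k] k, ∀ a r, M.incl r = B.piR a → ε r = B.counit a := by
  have h : ∀ x, M.proj x = 0 → B.counit x = 0 := fun x hx =>
    B.counit_eq_zero M ((M.proj_eq_zero_iff x).1 hx)
  obtain ⟨ε, hε⟩ := exists_comp_eq_of_surjective M.proj_surjective h
  refine ⟨ε, fun a r hr => ?_, fun ε' hε' => LinearMap.ext fun r => ?_⟩
  · rw [← hε, show r = M.proj a from M.incl_injective (by rw [hr, M.incl_proj]),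
      LinearMap.comp_apply]
  · obtain ⟨a, rfl⟩ := M.proj_surjective r
    rw [hε' a _ (M.incl_proj a), ← hε, LinearMap.comp_apply]

/-! ### The multiplier `F` and the map `(- ⊗ 1)F`. -/

theorem T₂_mul_left (x a b : A) : B.T₂ ((x * a) ⊗ₜ[k] b) = left₁ A x (B.T₂ (a ⊗ₜ[k] b)) := by
  refine B.cancel_right₂ fun d => ?_
  rw [← B.left₁_T₁, ← left₁_right₂, ← B.left₁_T₁]
  generalize B.T₁ (b ⊗ₜ[k] d) = w
  induction w using TensorProduct.induction_on with
  | zero => simp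
  | add u v hu hv => simp only [map_add, hu, hv]
  | tmul u v => simp [mul_assoc]

/-- Both sides are `(1 ⊗ q)Δ(b)(c ⊗ 1)`. -/
theorem right₁_T₃ (b c q : A) :
    right₁ A c (B.T₃ (b ⊗ₜ[k] q)) = left₂ A q (B.T₄ (c ⊗ₜ[k] b)) := by
  refine B.cancel_left₁ fun x => ?_
  rw [left₁_right₁, left₁_T₃, left_comm, ← B.regular_T₄, left₂_right₁]

theorem lact_piR_mul (q b c : A) :
    lact (B.piR q) (b * c) = evalR A B.counit (left₂ A q (B.T₄ (c ⊗ₜ[k] b))) := by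
  rw [B.lact_mul_apply, lact_piR, ← evalR_right₁, right₁_T₃]

theorem mul_ract_barPiR (a b t : A) :
    a * ract (B.barPiR t) b = evalR A B.counit (right₂ A t (B.T₂ (a ⊗ₜ[k] b))) := by
  rw [B.ract_barPiR, ← evalR_left₁, B.left₁_T₁]

/-- Let `T₂(a' ⊗ b') = Σ p ⊗ q` and `T₄(c ⊗ b) = Σ s ⊗ t`. Then `a'(b' ⊓̄ᴿ(t)) = Σ ϵ(qt) p` and
`⊓ᴿ(q)(bc) = Σ ϵ(qt) s`, so both sides are `Σ ϵ(qt) pa ⊗ c's`. -/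
theorem F_compat (a b c a' b' c' : A) :
    ((a' * b') ⊗ₜ[k] c') *
        ((lact.flip a) ∘ₗ B.barPiR).rTensor A (TensorProduct.comm k A A (B.T₄ (c ⊗ₜ[k] b))) =
      ((ract.flip c') ∘ₗ B.piR).lTensor A (B.T₂ (a' ⊗ₜ[k] b')) * (a ⊗ₜ[k] (b * c)) := by
  -- The common value: `(p ⊗ q) ⊗ (s ⊗ t) ↦ ϵ(qt) pa ⊗ c's`.
  let Θ : (A ⊗[k] A) ⊗[k] (A ⊗[k] A) →ₗ[k] A ⊗[k] A :=
    TensorProduct.map (LinearMap.mulRight k a) (LinearMap.mulLeft k c') ∘ₗ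
      evalR (A ⊗[k] A) (B.counit ∘ₗ LinearMap.mul' k A) ∘ₗ
        (TensorProduct.tensorTensorTensorComm k A A A A).toLinearMap
  have hl : ∀ w, ((a' * b') ⊗ₜ[k] c') *
      ((lact.flip a) ∘ₗ B.barPiR).rTensor A (TensorProduct.comm k A A w) =
        Θ (B.T₂ (a' ⊗ₜ[k] b') ⊗ₜ w) := by
    intro w
    induction w using TensorProduct.induction_on with
    | zero => simp
    | add u v hu hv => simp only [map_add, mul_add, TensorProduct.tmul_add, hu, hv]
    | tmul s t =>
      have h : ((a' * b') ⊗ₜ[k] c') * ((lact.flip a) ∘ₗ B.barPiR).rTensor A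
          (TensorProduct.comm k A A (s ⊗ₜ t)) =
          ((a' * ract (B.barPiR t) b') * a) ⊗ₜ[k] (c' * s) := by
        simp [mul_assoc, mul_lact, B.ract_mul_apply]
      rw [h, mul_ract_barPiR]
      generalize B.T₂ (a' ⊗ₜ[k] b') = U
      induction U using TensorProduct.induction_on with
      | zero => simp
      | add u v hu hv => simp only [map_add, add_mul, TensorProduct.add_tmul, hu, hv]
      | tmul p q => simp [Θ, TensorProduct.smul_tmul', smul_mul_assoc]
  have hr : ∀ U, ((ract.flip c') ∘ₗ B.piR).lTensor A U * (a ⊗ₜ[k] (b * c)) =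
        Θ (U ⊗ₜ B.T₄ (c ⊗ₜ[k] b)) := by
    intro U
    induction U using TensorProduct.induction_on with
    | zero => simp
    | add u v hu hv => simp only [map_add, add_mul, TensorProduct.add_tmul, hu, hv]
    | tmul p q =>
      have h : ((ract.flip c') ∘ₗ B.piR).lTensor A (p ⊗ₜ q) * (a ⊗ₜ[k] (b * c)) =
          (p * a) ⊗ₜ[k] (c' * lact (B.piR q) (b * c)) := by
        simp [mul_lact]
      rw [h, lact_piR_mul]
      generalize B.T₄ (c ⊗ₜ[k] b) = w
      induction w using TensorProduct.induction_on with
      | zero => simp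
      | add u v hu hv => simp only [map_add, mul_add, TensorProduct.tmul_add, hu, hv]
      | tmul s t => simp [Θ, mul_smul_comm, TensorProduct.tmul_smul]
  rw [hl, hr]

theorem lTensor_mul_surjective (B : RegularWeakMultiplierBialgebra k A) :
    Function.Surjective ((LinearMap.mul' k A).lTensor A) :=
  LinearMap.lTensor_surjective A B.idempotent

theorem rTensor_mul_surjective (B : RegularWeakMultiplierBialgebra k A) :
    Function.Surjective ((LinearMap.mul' k A).rTensor A) :=
  LinearMap.rTensor_surjective A B.idempotent

/-- The formulas prescribe the actions only before multiplying out, as `lF` and `rF` on triple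
tensors. By `F_compat`, `(μ ⊗ A)(u) lF(t) = rF(u) (A ⊗ μ)(t)`. Non-degeneracy then makes `lF` and
`rF` vanish on the kernels of `A ⊗ μ` and `μ ⊗ A`, so both descend, and the same identity makes the
resulting pair a multiplier. -/
theorem exists_isF : ∃ F, B.IsF F := by
  let lF : A ⊗[k] (A ⊗[k] A) →ₗ[k] A ⊗[k] A := (evalR A B.counit ∘ₗ B.E₁).rTensor A ∘ₗ
    (TensorProduct.assoc k A A A).symm.toLinearMap ∘ₗ LinearMap.lTensor A
      ((TensorProduct.comm k A A).toLinearMap ∘ₗ B.T₄ ∘ₗ (TensorProduct.comm k A A).toLinearMap)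
  let rF : (A ⊗[k] A) ⊗[k] A →ₗ[k] A ⊗[k] A := LinearMap.lTensor A
      (evalR A B.counit ∘ₗ B.E₂ ∘ₗ (TensorProduct.comm k A A).toLinearMap) ∘ₗ
    (TensorProduct.assoc k A A A).toLinearMap ∘ₗ B.T₂.rTensor A
  have hlF : ∀ a b c, lF (a ⊗ₜ (b ⊗ₜ c)) =
      ((lact.flip a) ∘ₗ B.barPiR).rTensor A (TensorProduct.comm k A A (B.T₄ (c ⊗ₜ[k] b))) := by
    intro a b c
    simp only [lF, LinearMap.comp_apply, LinearMap.lTensor_tmul, LinearEquiv.coe_coe,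
      TensorProduct.comm_tmul]
    generalize B.T₄ (c ⊗ₜ[k] b) = w
    induction w using TensorProduct.induction_on with
    | zero => simp
    | add u v hu hv => simp only [map_add, TensorProduct.tmul_add, hu, hv]
    | tmul s t => simp [B.lact_barPiR]
  have hrF : ∀ a b c, rF ((a ⊗ₜ b) ⊗ₜ c) =
      ((ract.flip c) ∘ₗ B.piR).lTensor A (B.T₂ (a ⊗ₜ[k] b)) := by
    intro a b c
    simp only [rF, LinearMap.comp_apply, LinearMap.rTensor_tmul, LinearEquiv.coe_coe]
    generalize B.T₂ (a ⊗ₜ[k] b) = w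
    induction w using TensorProduct.induction_on with
    | zero => simp
    | add u v hu hv => simp only [map_add, TensorProduct.add_tmul, hu, hv]
    | tmul s t => simp [ract_piR]
  have key : ∀ u t, (LinearMap.mul' k A).rTensor A u * lF t =
      rF u * (LinearMap.mul' k A).lTensor A t := by
    intro u t
    induction u using TensorProduct.induction_on with
    | zero => simp
    | add u v hu hv => simp only [map_add, add_mul, hu, hv]
    | tmul u c' =>
      induction u using TensorProduct.induction_on with
      | zero => simp
      | add u v hu hv => simp only [map_add, TensorProduct.add_tmul, add_mul, hu, hv]
      | tmul a' b' =>
        induction t using TensorProduct.induction_on with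
        | zero => simp
        | add u v hu hv => simp only [map_add, mul_add, hu, hv]
        | tmul a t =>
          induction t using TensorProduct.induction_on with
          | zero => simp
          | add u v hu hv => simp only [map_add, TensorProduct.tmul_add, mul_add, hu, hv]
          | tmul b c =>
            rw [hlF, hrF, LinearMap.rTensor_tmul, LinearMap.lTensor_tmul, LinearMap.mul'_apply,
              LinearMap.mul'_apply, F_compat]
  obtain ⟨l, hl⟩ := exists_comp_eq_of_surjective B.lTensor_mul_surjective (g := lF)
    fun t ht => B.cancel_mul_left fun z => by
      obtain ⟨u, rfl⟩ := B.rTensor_mul_surjective z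
      rw [key, ht, mul_zero, mul_zero]
  obtain ⟨r, hr⟩ := exists_comp_eq_of_surjective B.rTensor_mul_surjective (g := rF)
    fun u hu => B.cancel_mul fun a b => by
      obtain ⟨t, ht⟩ := B.lTensor_mul_surjective (a ⊗ₜ b)
      rw [← ht, ← key, hu, zero_mul, zero_mul]
  refine ⟨mkMultiplier l r fun x y => ?_, fun a b c => ?_, fun a b c => ?_⟩
  · obtain ⟨u, rfl⟩ := B.rTensor_mul_surjective x
    obtain ⟨t, rfl⟩ := B.lTensor_mul_surjective y
    rw [← LinearMap.comp_apply l, ← LinearMap.comp_apply r, hl, hr, key]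
  · rw [← hlF]
    exact LinearMap.congr_fun hl (a ⊗ₜ (b ⊗ₜ c))
  · rw [← hrF]
    exact LinearMap.congr_fun hr ((a ⊗ₜ b) ⊗ₜ c)

theorem existsUnique_F : ∃! F, B.IsF F := by
  obtain ⟨F, hF⟩ := B.exists_isF
  refine ⟨F, hF, fun F' hF' => B.ext_lact_tensor fun x => ?_⟩
  obtain ⟨t, rfl⟩ := B.lTensor_mul_surjective x
  induction t using TensorProduct.induction_on with
  | zero => simp
  | add u v hu hv => simp only [map_add, hu, hv]
  | tmul a t =>
    induction t using TensorProduct.induction_on with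
    | zero => simp
    | add u v hu hv => simp only [map_add, TensorProduct.tmul_add, hu, hv]
    | tmul b c =>
      rw [LinearMap.lTensor_tmul, LinearMap.mul'_apply, hF.1, hF'.1]

end RegularWeakMultiplierBialgebra

namespace BaseModel

variable {B : RegularWeakMultiplierBialgebra k A} {R : Type*} [AddCommGroup R] [Module k R]
  (M : BaseModel B R)

/-- The canonical map `A ⊗ R → M(A ⊗ A)`. -/
noncomputable def algTensor : A ⊗[k] R →ₗ[k] Multiplier k (A ⊗[k] A) :=
  tensorMultiplier ∘ₗ TensorProduct.map ofAlg M.incl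

/-- The canonical map `R ⊗ A → M(A ⊗ A)`. -/
noncomputable def tensorAlg : R ⊗[k] A →ₗ[k] Multiplier k (A ⊗[k] A) :=
  tensorMultiplier ∘ₗ TensorProduct.map M.incl ofAlg

theorem ract_algTensor (x : A ⊗[k] R) (y c : A) : ract (M.algTensor x) (y ⊗ₜ c) =
    left₁ A y ((ract.flip c ∘ₗ M.incl).lTensor A x) := by
  induction x using TensorProduct.induction_on with
  | zero => simp
  | add u v hu hv => simp only [map_add, LinearMap.add_apply, hu, hv]
  | tmul u v => simp [algTensor]

/-- Under the right action on `y ⊗ c` the first leg is only multiplied by `y`, which cancels; on the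
second leg `R` acts faithfully. -/
theorem algTensor_injective : Function.Injective M.algTensor := by
  intro x y h
  apply (TensorProduct.comm k A R).injective
  refine B.rapp_injective M.incl_injective fun c => ?_
  have h1 : ∀ x, rapp A M.incl c (TensorProduct.comm k A R x) =
      TensorProduct.comm k A A ((ract.flip c ∘ₗ M.incl).lTensor A x) := by
    intro x
    induction x using TensorProduct.induction_on with
    | zero => simp
    | add u v hu hv => simp only [map_add, hu, hv]
    | tmul u v => simp
  rw [h1, h1]
  congr 1
  refine B.cancel_left₁ fun d => ?_
  rw [← ract_algTensor, ← ract_algTensor, h]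

theorem ract_ofAlg_mul {F : Multiplier k (A ⊗[k] A)} (a x c : A) :
    ract (tensorMultiplier (ofAlg a ⊗ₜ[k] 1) * F) (x ⊗ₜ c) = ract F ((x * a) ⊗ₜ c) := by
  rw [ract_mul, ract_tensorMultiplier_tmul]
  simp

theorem algTensor_T₂ {F : Multiplier k (A ⊗[k] A)} (hF : B.IsF F) (a b : A) :
    M.algTensor (M.proj.lTensor A (B.T₂ (a ⊗ₜ b))) =
      tensorMultiplier (ofAlg (a * b) ⊗ₜ[k] 1) * F := by
  refine B.ext_ract_tensor fun w => ?_
  induction w using TensorProduct.induction_on with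
  | zero => simp
  | add u v hu hv => simp only [map_add, hu, hv]
  | tmul x c =>
    rw [ract_algTensor, ract_ofAlg_mul, ← mul_assoc, hF.2, B.T₂_mul_left,
      ← LinearMap.lTensor_comp_apply, lTensor_left₁, ← M.incl_comp_proj]
    rfl

/-- On products `algTensor_T₂` exhibits `(ab ⊗ 1)F` in the image of `A ⊗ R`; injectivity of
`algTensor` makes the preimage unique and linear in its argument. -/
theorem existsUnique_legF {F : Multiplier k (A ⊗[k] A)} (hF : B.IsF F) :
    ∃! D : A →ₗ[k] A ⊗[k] R, ∀ a, M.algTensor (D a) = tensorMultiplier (ofAlg a ⊗ₜ[k] 1) * F := by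
  let G : A →ₗ[k] Multiplier k (A ⊗[k] A) := LinearMap.mulRight k F ∘ₗ tensorMultiplier ∘ₗ
    (TensorProduct.mk k _ _).flip 1 ∘ₗ ofAlg
  have hG : ∀ a, ∃ y, M.algTensor y = G a := fun a => by
    induction a using B.mul_induction with
    | hmul a b => exact ⟨_, M.algTensor_T₂ hF a b⟩
    | hadd a b ha hb =>
      obtain ⟨x, hx⟩ := ha
      obtain ⟨y, hy⟩ := hb
      exact ⟨x + y, by rw [map_add, map_add, hx, hy]⟩
  obtain ⟨D, hD⟩ := exists_comp_eq_of_injective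
    (Z := Multiplier k (A ⊗[k] A)) M.algTensor_injective hG
  refine ⟨D, fun a => LinearMap.congr_fun hD a, fun D' hD' => LinearMap.ext fun a => ?_⟩
  apply M.algTensor_injective
  rw [hD' a]
  exact (LinearMap.congr_fun hD a).symm

theorem legF_mul {F : Multiplier k (A ⊗[k] A)} (hF : B.IsF F) {D : A →ₗ[k] A ⊗[k] R}
    
    (hD : ∀ a, M.algTensor (D a) = tensorMultiplier (ofAlg a ⊗ₜ[k] 1) * F) (a b : A) :
    D (a * b) = M.proj.lTensor A (B.T₂ (a ⊗ₜ b)) := by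
  apply M.algTensor_injective
  rw [hD, M.algTensor_T₂ hF]

end BaseModel

end CounitAndF

/-! ### The comodules `A` and `R`. -/

section Comodules

set_option linter.unusedSectionVars false

variable {k : Type*} [Field k] {A : Type*} [NonUnitalRing A] [Module k A]
  [IsScalarTower k A A] [SMulCommClass k A A]

namespace RegularWeakMultiplierBialgebra

variable (B : RegularWeakMultiplierBialgebra k A)

/-- The map `a ↦ Δ(a) z`. -/
noncomputable def comulApp (z : A ⊗[k] A) : A →ₗ[k] A ⊗[k] A where
  toFun a := B.comulL a z
  map_add' a b := by
    induction z using TensorProduct.induction_on with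
    | zero => simp
    | add u v hu hv => rw [map_add, map_add, map_add, hu, hv]; abel
    | tmul x y => simp [TensorProduct.add_tmul]
  map_smul' c a := by
    induction z using TensorProduct.induction_on with
    | zero => simp
    | add u v hu hv => rw [map_add, map_add, smul_add, hu, hv]
    | tmul x y => simp [← TensorProduct.smul_tmul']

@[simp] theorem comulApp_apply (z : A ⊗[k] A) (a : A) : B.comulApp z a = B.comulL a z := rfl

/-- `(x ⊗ 1 ⊗ 1) (Δ ⊗ A)(Δ(v)) (1 ⊗ z) = (A ⊗ Δ)(T₂(x ⊗ v)) (1 ⊗ z)` -/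
theorem left₁_leg12_leg13_T₁ (x v : A) (z : A ⊗[k] A) :
    left₁ (A ⊗[k] A) x (leg12 A B.T₁ (leg13 A B.T₁ (v ⊗ₜ z))) =
      (B.comulApp z).lTensor A (B.T₂ (x ⊗ₜ v)) := by
  induction z using TensorProduct.induction_on with
  | zero =>
    have h : B.comulApp 0 = 0 := by ext; simp
    simp [h]
  | add z w hz hw =>
    have h : B.comulApp (z + w) = B.comulApp z + B.comulApp w := by ext; simp
    rw [TensorProduct.tmul_add, map_add, map_add, map_add, hz, hw, h, LinearMap.lTensor_add,
      LinearMap.add_apply]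
  | tmul a b =>
    -- The factor `x` turns the outer `T₁` into `T₂`, so that the coassociativity axiom applies.
    have h : ∀ y : A ⊗[k] A, left₁ (A ⊗[k] A) x
        (leg12 A B.T₁ ((TensorProduct.mk k A A a).lTensor A y)) =
        (right₁ A a).lTensor A (leg12 A B.T₂ (x ⊗ₜ y)) := by
      intro y
      induction y using TensorProduct.induction_on with
      | zero => simp
      | add u v hu hv => simp only [TensorProduct.tmul_add, map_add, hu, hv]
      | tmul s t =>
        rw [LinearMap.lTensor_tmul, TensorProduct.mk_apply, leg12_tmul, leg12_tmul, ← lTensor_left₁,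
          B.left₁_T₁]
        unfold right₂
        simp only [← LinearMap.lTensor_comp_apply]
        rfl
    have h2 := LinearMap.congr_fun B.coassoc (x ⊗ₜ[k] (v ⊗ₜ[k] b))
    simp only [LinearMap.comp_apply, LinearMap.lTensor_tmul, leg12_tmul] at h2
    rw [leg13_tmul, h, h2]
    simp only [← LinearMap.lTensor_comp_apply]
    rfl

/-- By `left₁_leg12_leg13_T₁` the idempotent stands right behind a comultiplication, which absorbs
it: `Δ(a)E = Δ(a)`. -/
theorem leg12_leg13_E₁ (v : A) (z : A ⊗[k] A) :
    leg12 A B.T₁ (leg13 A B.T₁ (v ⊗ₜ B.E₁ z)) = leg12 A B.T₁ (leg13 A B.T₁ (v ⊗ₜ z)) := by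
  refine B.cancel_left₁ fun x => ?_
  rw [left₁_leg12_leg13_T₁, left₁_leg12_leg13_T₁]
  congr 2
  ext a
  simp [B.comulL_E₁]

/-- The formula `left₁_leg12_leg13_T₁` reduces the comodule axiom to multiplicativity, `Δ(qa) =
Δ(q)Δ(a)`. -/
theorem leg12_leg13_T₁ (v a b : A) : leg12 A B.T₁ (leg13 A B.T₁ (v ⊗ₜ B.T₁ (a ⊗ₜ b))) =
    B.T₁.lTensor A (leg12 A B.T₁ (v ⊗ₜ (a ⊗ₜ b))) := by
  refine B.cancel_left₁ fun x => ?_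
  rw [left₁_leg12_leg13_T₁, leg12_tmul, ← lTensor_left₁, ← lTensor_left₁, B.left₁_T₁]
  unfold right₂
  simp only [← LinearMap.lTensor_comp_apply]
  congr 2
  refine LinearMap.ext fun q => ?_
  simp [B.T₁_mul]

/-- The right comodule `(A, T₁, T₃)`. -/
noncomputable def regularComodule : RightComodule B A where
  lam := B.T₁
  rho := B.T₃
  compat v a b := B.regular_T₃ a b v
  normalized := TensorProduct.ext' fun v z => B.leg12_leg13_E₁ v z
  coassoc := TensorProduct.ext_threefold' fun v a b => B.leg12_leg13_T₁ v a b

end RegularWeakMultiplierBialgebra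

theorem RightComodule.ext' {B : RegularWeakMultiplierBialgebra k A} {V : Type*} [AddCommGroup V]
    [Module k V] {C C' : RightComodule B V} (hl : C.lam = C'.lam) (hr : C.rho = C'.rho) :
    C = C' := by
  cases C
  cases C'
  congr

/-- A linear map commuting with the first structure maps is a comodule homomorphism. -/
theorem RightComodule.mem_homs_of_lam {B : RegularWeakMultiplierBialgebra k A} {V V' : Type*}
    [AddCommGroup V] [Module k V] [AddCommGroup V'] [Module k V'] {C : RightComodule B V}
    {C' : RightComodule B V'} {f : V →ₗ[k] V'}
    (h : C'.lam ∘ₗ f.rTensor A = f.rTensor A ∘ₗ C.lam) : f ∈ C.homs C' := by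
  refine ⟨h, TensorProduct.ext' fun v a => B.cancel_right₂ fun b => ?_⟩
  have hl : ∀ x : V ⊗[k] A, left₂ V' a (f.rTensor A x) = f.rTensor A (left₂ V a x) := by
    intro x
    simp only [left₂, ← LinearMap.comp_apply, LinearMap.lTensor_comp_rTensor,
      LinearMap.rTensor_comp_lTensor]
  have hr : ∀ x : V ⊗[k] A, right₂ V' b (f.rTensor A x) = f.rTensor A (right₂ V b x) := by
    intro x
    simp only [right₂, ← LinearMap.comp_apply, LinearMap.lTensor_comp_rTensor,
      LinearMap.rTensor_comp_lTensor]
  have h' := LinearMap.congr_fun h (v ⊗ₜ b)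
  simp only [LinearMap.comp_apply, LinearMap.rTensor_tmul] at h' ⊢
  -- After multiplication by `1 ⊗ b`, `compat` expresses `rho` through `lam`.
  rw [← C'.compat, h', hl, C.compat, hr]

namespace BaseModel

variable {B : RegularWeakMultiplierBialgebra k A} {R : Type*} [AddCommGroup R] [Module k R]
  (M : BaseModel B R)

theorem lact_tensorAlg (x : R ⊗[k] A) (c d : A) :
    lact (M.tensorAlg x) (c ⊗ₜ d) = right₂ A d (lapp A M.incl c x) := by
  induction x using TensorProduct.induction_on with
  | zero => simp
  | add u v hu hv => simp only [map_add, LinearMap.add_apply, hu, hv]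
  | tmul u v => simp [tensorAlg]

theorem ract_tensorAlg (x : R ⊗[k] A) (c d : A) :
    ract (M.tensorAlg x) (c ⊗ₜ d) = left₂ A d (rapp A M.incl c x) := by
  induction x using TensorProduct.induction_on with
  | zero => simp
  | add u v hu hv => simp only [map_add, LinearMap.add_apply, hu, hv]
  | tmul u v => simp [tensorAlg]

theorem tensorAlg_injective : Function.Injective M.tensorAlg := by
  intro x y h
  refine B.lapp_injective M.incl_injective fun c => B.cancel_right₂ fun d => ?_
  rw [← lact_tensorAlg, ← lact_tensorAlg, h]

/-- Replaces an equation of multipliers on `A ⊗ A` by one in `A ⊗ A`: the second leg enters only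
through right multiplication by `d`, which cancels. -/
theorem tensorAlg_eq_E_mul_iff (x : R ⊗[k] A) (a : A) :
    M.tensorAlg x = B.E * tensorMultiplier (1 ⊗ₜ[k] ofAlg a) ↔
      ∀ c, lapp A M.incl c x = B.E₁ (c ⊗ₜ a) := by
  have h : ∀ c d, lact (B.E * tensorMultiplier (1 ⊗ₜ[k] ofAlg a)) (c ⊗ₜ d) =
      right₂ A d (B.E₁ (c ⊗ₜ a)) := by
    intro c d
    rw [← B.E₁_right₂, lact_mul, lact_tensorMultiplier_tmul]
    rfl
  refine ⟨fun hx c => B.cancel_right₂ fun d => ?_, fun hx => B.ext_lact_tensor fun w => ?_⟩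
  · rw [← lact_tensorAlg, hx, h]
  · induction w using TensorProduct.induction_on with
    | zero => simp
    | add u v hu hv => simp only [map_add, hu, hv]
    | tmul c d => rw [lact_tensorAlg, hx, h]

theorem tensorAlg_eq_mul_E_iff (x : R ⊗[k] A) (a : A) :
    M.tensorAlg x = tensorMultiplier (1 ⊗ₜ[k] ofAlg a) * B.E ↔
      ∀ c, rapp A M.incl c x = B.E₂ (c ⊗ₜ a) := by
  have h : ∀ c d, ract (tensorMultiplier (1 ⊗ₜ[k] ofAlg a) * B.E) (c ⊗ₜ d) =
      left₂ A d (B.E₂ (c ⊗ₜ a)) := by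
    intro c d
    rw [← B.E₂_left₂, ract_mul, ract_tensorMultiplier_tmul]
    rfl
  refine ⟨fun hx c => B.cancel_left₂ fun d => ?_, fun hx => B.ext_ract_tensor fun w => ?_⟩
  · rw [← ract_tensorAlg, hx, h]
  · induction w using TensorProduct.induction_on with
    | zero => simp
    | add u v hu hv => simp only [map_add, hu, hv]
    | tmul c d => rw [ract_tensorAlg, hx, h]

/-- For a product the element is `(⊓̄ᴿ ⊗ A)T₁(a ⊗ b)`; right fullness places its first leg in `R`.
-/
theorem exists_lapp_eq (hB : B.RightFull) (a : A) :
    ∃ x : R ⊗[k] A, ∀ c, lapp A M.incl c x = B.E₁ (c ⊗ₜ a) := by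
  obtain ⟨p, hp⟩ := exists_comp_eq_of_injective M.incl_injective (g := B.barPiR)
    fun a => M.exists_incl_eq ((B.range_barPiR hB).le ⟨a, rfl⟩)
  induction a using B.mul_induction with
  | hmul a b =>
    exact ⟨p.rTensor A (B.T₁ (a ⊗ₜ b)), fun c => by rw [lapp_rTensor, hp, B.lapp_barPiR_T₁]⟩
  | hadd a b ha hb =>
    obtain ⟨x, hx⟩ := ha
    obtain ⟨y, hy⟩ := hb
    exact ⟨x + y, fun c => by rw [map_add, hx, hy, TensorProduct.tmul_add, map_add]⟩

/-- The element `(1 ⊗ a) E` of `R ⊗ A`; its value under the counit of `R` is `a`. -/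
theorem exists_rapp_eq (a : A) : ∃ x : R ⊗[k] A, (∀ c, rapp A M.incl c x = B.E₂ (c ⊗ₜ a)) ∧
    ∀ ε : R →ₗ[k] k, ε ∘ₗ M.proj = B.counit → evalL A ε x = a := by
  induction a using B.mul_induction with
  | hmul a b =>
    refine ⟨M.proj.rTensor A (B.T₃ (b ⊗ₜ a)), fun c => ?_, fun ε hε => ?_⟩
    · rw [rapp_rTensor, M.incl_comp_proj, B.rapp_piR_T₃]
    · rw [evalL_rTensor, hε, B.evalL_T₃]
  | hadd a b ha hb =>
    obtain ⟨x, hx, hx'⟩ := ha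
    obtain ⟨y, hy, hy'⟩ := hb
    exact ⟨x + y, fun c => by rw [map_add, hx, hy, TensorProduct.tmul_add, map_add],
      fun ε hε => by rw [map_add, hx' ε hε, hy' ε hε]⟩

/-- Only one element of `R ⊗ A` represents `(1 ⊗ a)E`, so the value of the counit found in
`exists_rapp_eq` applies to it. -/
theorem evalL_eq_of_rapp_eq {ε : R →ₗ[k] k} (hε : ε ∘ₗ M.proj = B.counit) {x : R ⊗[k] A} {a : A}
    (h : ∀ c, rapp A M.incl c x = B.E₂ (c ⊗ₜ a)) : evalL A ε x = a := by
  obtain ⟨y, hy, hy'⟩ := M.exists_rapp_eq a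
  rw [← hy' ε hε]
  congr 1
  exact B.rapp_injective M.incl_injective fun c => by rw [h, hy]

/-- The structure maps of `C` are `r ⊗ a ↦ E (1 ⊗ r a)` and `r ⊗ a ↦ (1 ⊗ a r) E`. -/
def IsBase (C : RightComodule B R) : Prop :=
  (∀ (r : R) (a : A), M.tensorAlg (C.lam (r ⊗ₜ[k] a)) =
    B.E * tensorMultiplier (1 ⊗ₜ[k] ofAlg (lact (M.incl r) a))) ∧
  (∀ (r : R) (a : A), M.tensorAlg (C.rho (r ⊗ₜ[k] a)) =
    tensorMultiplier (1 ⊗ₜ[k] ofAlg (ract (M.incl r) a)) * B.E)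

theorem lapp_leg12 {l : R ⊗[k] A →ₗ[k] R ⊗[k] A}
    (hl : ∀ r a c, lapp A M.incl c (l (r ⊗ₜ a)) = B.E₁ (c ⊗ₜ lact (M.incl r) a)) (r : R)
    (a b c : A) : lapp (A ⊗[k] A) M.incl c (leg12 A l (r ⊗ₜ (a ⊗ₜ b))) =
      leg12 A B.E₁ (c ⊗ₜ (lact (M.incl r) a ⊗ₜ b)) := by
  rw [leg12_tmul, leg12_tmul, lapp_lTensor, hl]

/-- If `l(r ⊗ b) = Σ s ⊗ t`, the composite sends `r ⊗ a ⊗ b` to `Σ E(1 ⊗ sa) ⊗ t`, and `Σ sa ⊗ t =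
E(a ⊗ rb)`. It remains to move `E` past `1 ⊗ r`. -/
theorem lapp_leg12_leg13 (hB : B.RightFull) {l : R ⊗[k] A →ₗ[k] R ⊗[k] A}
    (hl : ∀ r a c, lapp A M.incl c (l (r ⊗ₜ a)) = B.E₁ (c ⊗ₜ lact (M.incl r) a)) (r : R)
    (z : A ⊗[k] A) (c : A) : lapp (A ⊗[k] A) M.incl c (leg12 A l (leg13 A l (r ⊗ₜ z))) =
      leg12 A B.E₁ (c ⊗ₜ (lact (M.incl r)).lTensor A (B.E₁ z)) := by
  rw [← B.E₁_lact_base hB (M.incl_mem r)]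
  induction z using TensorProduct.induction_on with
  | zero => simp
  | add u v hu hv => simp only [TensorProduct.tmul_add, map_add, hu, hv]
  | tmul a b =>
    have h : ∀ y : R ⊗[k] A, lapp (A ⊗[k] A) M.incl c
        (leg12 A l ((TensorProduct.mk k A A a).lTensor R y)) =
          leg12 A B.E₁ (c ⊗ₜ lapp A M.incl a y) := by
      intro y
      induction y using TensorProduct.induction_on with
      | zero => simp
      | add u v hu hv => simp only [TensorProduct.tmul_add, map_add, hu, hv]
      | tmul s t =>
        rw [LinearMap.lTensor_tmul, TensorProduct.mk_apply, M.lapp_leg12 hl, lapp_tmul]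
    rw [leg13_tmul, h, hl, LinearMap.lTensor_tmul]

/-- Compatibility is `(1 ⊗ a)E(1 ⊗ rb) = (1 ⊗ ar)E(1 ⊗ b)`, true because `E` commutes with `1 ⊗ r`.
Normalization comes from `E² = E`, and coassociativity from `E T₁ = T₁`, `(1 ⊗ r)Δ(a) = Δ(ra)` and
the axiom `E_T₁`. -/
theorem exists_comodule (hB : B.RightFull) : ∃ C : RightComodule B R, M.IsBase C := by
  let G : R ⊗[k] A →ₗ[k] Multiplier k (A ⊗[k] A) := LinearMap.mulLeft k B.E ∘ₗ
    tensorMultiplier ∘ₗ TensorProduct.mk k _ _ 1 ∘ₗ ofAlg ∘ₗ TensorProduct.lift (lact ∘ₗ M.incl)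
  let H : R ⊗[k] A →ₗ[k] Multiplier k (A ⊗[k] A) := LinearMap.mulRight k B.E ∘ₗ
    tensorMultiplier ∘ₗ TensorProduct.mk k _ _ 1 ∘ₗ ofAlg ∘ₗ TensorProduct.lift (ract ∘ₗ M.incl)
  have hG : ∀ x, ∃ y, M.tensorAlg y = G x := fun x => by
    obtain ⟨y, hy⟩ := M.exists_lapp_eq hB (TensorProduct.lift (lact ∘ₗ M.incl) x)
    exact ⟨y, (M.tensorAlg_eq_E_mul_iff _ _).2 hy⟩
  have hH : ∀ x, ∃ y, M.tensorAlg y = H x := fun x => by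
    obtain ⟨y, hy, -⟩ := M.exists_rapp_eq (TensorProduct.lift (ract ∘ₗ M.incl) x)
    exact ⟨y, (M.tensorAlg_eq_mul_E_iff _ _).2 hy⟩
  obtain ⟨l, hl⟩ := exists_comp_eq_of_injective (Z := Multiplier k (A ⊗[k] A))
    M.tensorAlg_injective hG
  obtain ⟨ρ, hρ⟩ := exists_comp_eq_of_injective (Z := Multiplier k (A ⊗[k] A))
    M.tensorAlg_injective hH
  have hl : ∀ r a, M.tensorAlg (l (r ⊗ₜ[k] a)) =
      B.E * tensorMultiplier (1 ⊗ₜ[k] ofAlg (lact (M.incl r) a)) :=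
    fun r a => LinearMap.congr_fun hl (r ⊗ₜ a)
  have hρ : ∀ r a, M.tensorAlg (ρ (r ⊗ₜ[k] a)) =
      tensorMultiplier (1 ⊗ₜ[k] ofAlg (ract (M.incl r) a)) * B.E :=
    fun r a => LinearMap.congr_fun hρ (r ⊗ₜ a)
  have hl' : ∀ r a c, lapp A M.incl c (l (r ⊗ₜ a)) = B.E₁ (c ⊗ₜ lact (M.incl r) a) :=
    fun r a => (M.tensorAlg_eq_E_mul_iff _ _).1 (hl r a)
  have hρ' : ∀ r a c, rapp A M.incl c (ρ (r ⊗ₜ a)) = B.E₂ (c ⊗ₜ ract (M.incl r) a) :=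
    fun r a => (M.tensorAlg_eq_mul_E_iff _ _).1 (hρ r a)
  refine ⟨⟨l, ρ, fun r a b => ?_, TensorProduct.ext' fun r z => ?_,
    TensorProduct.ext_threefold' fun r a b => ?_⟩, hl, hρ⟩
  · refine B.lapp_injective M.incl_injective fun c => B.cancel_left₁ fun d => ?_
    rw [lapp_left₂, lapp_right₂, hl', ← tmul_mul, left₁_right₂, left₁_lapp, hρ', ← right_comm,
      ← mul_tmul, ← B.mul_E₁, ← LinearMap.lTensor_tmul, B.E₁_lact_base hB (M.incl_mem r),
      mul_lTensor_lact, LinearMap.lTensor_tmul]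
  · refine B.lapp_injective M.incl_injective fun c => ?_
    simp only [LinearMap.comp_apply, LinearMap.lTensor_tmul]
    rw [M.lapp_leg12_leg13 hB hl', M.lapp_leg12_leg13 hB hl', ← LinearMap.comp_apply B.E₁ B.E₁,
      B.E_idem]
  · refine B.lapp_injective M.incl_injective fun c => ?_
    simp only [LinearMap.comp_apply, LinearMap.lTensor_tmul]
    rw [M.lapp_leg12_leg13 hB hl', B.E₁_T₁, ← B.T₁_lact_base (M.incl_mem r), lapp_lTensor,
      M.lapp_leg12 hl']
    exact LinearMap.congr_fun B.E_T₁ (c ⊗ₜ (lact (M.incl r) a ⊗ₜ b))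

theorem existsUnique_comodule (hB : B.RightFull) : ∃! C : RightComodule B R, M.IsBase C := by
  obtain ⟨C, hC⟩ := M.exists_comodule hB
  refine ⟨C, hC, fun C' hC' => RightComodule.ext' (TensorProduct.ext' fun r a => ?_)
    (TensorProduct.ext' fun r a => ?_)⟩
  · exact M.tensorAlg_injective (by rw [hC.1, hC'.1])
  · exact M.tensorAlg_injective (by rw [hC.2, hC'.2])

end BaseModel

end Comodules

/-! ### Comodule homomorphisms `A → R` and right integrals. -/

section Integrals

set_option linter.unusedSectionVars false

variable {k : Type*} [Field k] {A : Type*} [NonUnitalRing A] [Module k A]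
  [IsScalarTower k A A] [SMulCommClass k A A]

namespace BaseModel

variable {B : RegularWeakMultiplierBialgebra k A} {R : Type*} [AddCommGroup R] [Module k R]
  (M : BaseModel B R)

/-- A comodule homomorphism `Ψ : A → R` satisfies `a ↼ (ε Ψ) = Ψ(a)`. -/
theorem harpoon_counit_comp {CA : RightComodule B A} {CR : RightComodule B R}
    (hCA : CA.IsRegular) (hCR : M.IsBase CR) {ε : R →ₗ[k] k} (hε : ε ∘ₗ M.proj = B.counit)
    {Ψ : A →ₗ[k] R} (hΨ : Ψ ∈ CA.homs CR) (a : A) : B.harpoon a (ε ∘ₗ Ψ) = M.incl (Ψ a) := by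
  refine B.ext_ract fun b => ?_
  -- Apply `ε` to the first leg of `(1 ⊗ bΨ(a))E = (Ψ ⊗ A)T₃(a ⊗ b)`: the left side becomes `bΨ(a)`,
  -- the right side `b(a ↼ εΨ)`.
  have h := LinearMap.congr_fun hΨ.2 (a ⊗ₜ b)
  rw [LinearMap.comp_apply, LinearMap.comp_apply, LinearMap.rTensor_tmul, hCA.2] at h
  rw [← M.evalL_eq_of_rapp_eq hε ((M.tensorAlg_eq_mul_E_iff _ _).1 (hCR.2 (Ψ a) b)), h,
    evalL_rTensor]
  rfl

/-- Since `Ψ(s)c = (ψ ⊗ A)T₁(s ⊗ c)`, acting on `c` produces the iterated comultiplication with `ψ`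
on its first leg, to which the axioms of the comodule `A` apply. -/
theorem lapp_rTensor_T₁ {Ψ : A →ₗ[k] R} {ψ : A →ₗ[k] k}
    (h : ∀ a, M.incl (Ψ a) = B.harpoon a ψ) (a b c : A) :
    lapp A M.incl c (Ψ.rTensor A (B.T₁ (a ⊗ₜ b))) =
      evalL (A ⊗[k] A) ψ (leg12 A B.T₁ (leg13 A B.T₁ (a ⊗ₜ (c ⊗ₜ b)))) := by
  rw [leg13_tmul]
  generalize B.T₁ (a ⊗ₜ b) = y
  induction y using TensorProduct.induction_on with
  | zero => simp
  | add u v hu hv => simp only [map_add, hu, hv]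
  | tmul s t =>
    rw [LinearMap.lTensor_tmul, TensorProduct.mk_apply, leg12_tmul, evalL_lTensor,
      LinearMap.rTensor_tmul, lapp_tmul, h]
    rfl

/-- `Ψ(a₁) ⊗ a₂ = (1 ⊗ Ψ(a)) E` for a right integral `ψ` and `Ψ(a) = a ↼ ψ` -/
theorem evalL_leg12_leg13 {Ψ : A →ₗ[k] R} {ψ : A →ₗ[k] k}
    (h : ∀ a, M.incl (Ψ a) = B.harpoon a ψ) (a : A) (z : A ⊗[k] A) :
    evalL (A ⊗[k] A) ψ (leg12 A B.T₁ (leg13 A B.T₁ (a ⊗ₜ z))) =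
      (lact (M.incl (Ψ a))).lTensor A (B.E₁ z) := by
  -- Right multiplication by `d` passes through because `Ψ(s)` acts right `A`-linearly; the elements
  -- spanning the range of `E₁` carry such a factor.
  have hr : ∀ (d : A) (z : A ⊗[k] A),
      evalL (A ⊗[k] A) ψ (leg12 A B.T₁ (leg13 A B.T₁ (a ⊗ₜ right₁ A d z))) =
        right₁ A d (evalL (A ⊗[k] A) ψ (leg12 A B.T₁ (leg13 A B.T₁ (a ⊗ₜ z)))) := by
    intro d z
    induction z using TensorProduct.induction_on with
    | zero => simp
    | add u v hu hv => simp only [map_add, TensorProduct.tmul_add, hu, hv]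
    | tmul c b =>
      rw [right₁_tmul, ← M.lapp_rTensor_T₁ h, ← M.lapp_rTensor_T₁ h]
      generalize Ψ.rTensor A (B.T₁ (a ⊗ₜ b)) = y
      induction y using TensorProduct.induction_on with
      | zero => simp
      | add u v hu hv => simp only [map_add, hu, hv]
      | tmul s t => simp [B.lact_mul_apply]
  -- Normalization replaces `z` by `E z`, so it suffices to treat `T₁(c ⊗ b)(d ⊗ 1)`.
  rw [← B.leg12_leg13_E₁]
  refine B.E₁_induction (p := fun w =>
    evalL (A ⊗[k] A) ψ (leg12 A B.T₁ (leg13 A B.T₁ (a ⊗ₜ w))) =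
      (lact (M.incl (Ψ a))).lTensor A w) (by simp) (fun x y hx hy => ?_) (fun c x hx => ?_)
    (fun c d b => ?_) z
  · rw [TensorProduct.tmul_add, map_add, map_add, map_add, map_add, hx, hy]
  · rw [TensorProduct.tmul_smul, map_smul, map_smul, map_smul, map_smul, hx]
  -- Coassociativity produces `T₁((a ↼ ψ)c ⊗ b)`, which is `(1 ⊗ Ψ(a))T₁(c ⊗ b)` because `Ψ(a) = a ↼
  -- ψ` lies in `R`.
  · rw [hr, B.leg12_leg13_T₁, evalL_lTensor, leg12_tmul, evalL_lTensor, lTensor_right₁,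
      ← B.T₁_lact_base (M.incl_mem _), h]
    rfl

/-- For a right integral `ψ`, the map `a ↦ a ↼ ψ` is a comodule homomorphism. -/
theorem mem_homs_of_harpoon (hB : B.RightFull) {CA : RightComodule B A} {CR : RightComodule B R}
    (hCA : CA.IsRegular) (hCR : M.IsBase CR) {Ψ : A →ₗ[k] R} {ψ : A →ₗ[k] k}
    (h : ∀ a, M.incl (Ψ a) = B.harpoon a ψ) : Ψ ∈ CA.homs CR := by
  refine RightComodule.mem_homs_of_lam (TensorProduct.ext' fun a b =>
    B.lapp_injective M.incl_injective fun c => ?_)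
  rw [LinearMap.comp_apply, LinearMap.comp_apply, LinearMap.rTensor_tmul, hCA.1,
    (M.tensorAlg_eq_E_mul_iff _ _).1 (hCR.1 (Ψ a) b), M.lapp_rTensor_T₁ h,
    M.evalL_leg12_leg13 h, ← B.E₁_lact_base hB (M.incl_mem _), LinearMap.lTensor_tmul]

theorem lact_algTensor (x : A ⊗[k] R) (a d : A) : lact (M.algTensor x) (a ⊗ₜ d) =
    right₁ A a ((lact.flip d ∘ₗ M.incl).lTensor A x) := by
  induction x using TensorProduct.induction_on with
  | zero => simp
  | add u v hu hv => simp only [map_add, LinearMap.add_apply, hu, hv]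
  | tmul u v => simp [algTensor]

/-- `(ψ ⊗ R)((a ⊗ 1) F) = a ↼ ψ` for a right integral `ψ` -/
theorem incl_evalL_legF {F : Multiplier k (A ⊗[k] A)} (hF : B.IsF F) {D : A →ₗ[k] A ⊗[k] R}
    (hD : ∀ a, M.algTensor (D a) = tensorMultiplier (ofAlg a ⊗ₜ[k] 1) * F) {ψ : A →ₗ[k] k}
    (hψ : ψ ∈ B.rightIntegrals) (x : A) : M.incl (evalL R ψ (D x)) = B.harpoon x ψ := by
  -- With `T₄(c ⊗ b) = Σ s ⊗ t` this reads `(x ⊗ 1)F(1 ⊗ bc) = Σ x ⊓̄ᴿ(t) ⊗ s`.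
  have key : ∀ b c, (lact.flip (b * c) ∘ₗ M.incl).lTensor A (D x) =
      rapp A B.barPiR x (TensorProduct.comm k A A (B.T₄ (c ⊗ₜ b))) := by
    intro b c
    refine B.cancel_right₁ fun a => ?_
    have h : ∀ w : A ⊗[k] A, TensorProduct.map (LinearMap.mulLeft k x) LinearMap.id w =
        left₁ A x w := fun _ => rfl
    rw [← lact_algTensor, hD, lact_mul, hF.1, lact_tensorMultiplier_tmul, lact_ofAlg, lact_one, h,
      ← left₁_lapp]
    rfl
  obtain ⟨y, hy⟩ := hψ x
  refine B.ext_lact fun d => ?_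
  induction d using B.mul_induction with
  | hadd b c hb hc => rw [map_add, map_add, hb, hc]
  | hmul b c =>
    have h := congrArg (evalL A ψ) (key b c)
    rw [evalL_lTensor] at h
    refine Eq.trans h ?_
    rw [← hy, B.lact_piR_mul]
    generalize B.T₄ (c ⊗ₜ b) = w
    induction w using TensorProduct.induction_on with
    | zero => simp
    | add u v hu hv => simp only [map_add, hu, hv]
    | tmul s t =>
      -- Here `ψ(x ⊓̄ᴿ(t)) = ϵ((x ↼ ψ)t)`, and this is `ϵ(yt)` because `x ↼ ψ = ⊓ᴿ(y)`: this is the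
      -- use of the integral property.
      rw [TensorProduct.comm_tmul, rapp_tmul, evalL_tmul, left₂_tmul, evalR_tmul,
        ← B.counit_lact_piR, hy, B.ract_barPiR, ← evalR_evalL]
      rfl

/-- On a product, `(bc ⊗ 1)F = (A ⊗ ⊓ᴿ)T₂(b ⊗ c)`, and the counit on the second leg returns `bc`. -/
theorem counit_evalL_legF {F : Multiplier k (A ⊗[k] A)} (hF : B.IsF F) {D : A →ₗ[k] A ⊗[k] R}
    (hD : ∀ a, M.algTensor (D a) = tensorMultiplier (ofAlg a ⊗ₜ[k] 1) * F) {ε : R →ₗ[k] k}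
    (hε : ε ∘ₗ M.proj = B.counit) (ψ : A →ₗ[k] k) (a : A) : ε (evalL R ψ (D a)) = ψ a := by
  induction a using B.mul_induction with
  | hadd b c hb hc => rw [map_add, map_add, map_add, map_add, hb, hc]
  | hmul b c =>
    rw [M.legF_mul hF hD, evalL_lTensor, ← LinearMap.comp_apply ε, hε, evalR_evalL, B.evalR_T₂]

/-- For `ψ = εΨ` both `Ψ(a)` and `(ψ ⊗ R)((a ⊗ 1)F)` equal `a ↼ ψ`. -/
theorem evalL_counit_comp_legF {CA : RightComodule B A} {CR : RightComodule B R}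
    (hCA : CA.IsRegular) (hCR : M.IsBase CR) {ε : R →ₗ[k] k} (hε : ε ∘ₗ M.proj = B.counit)
    {F : Multiplier k (A ⊗[k] A)} (hF : B.IsF F) {D : A →ₗ[k] A ⊗[k] R}
    (hD : ∀ a, M.algTensor (D a) = tensorMultiplier (ofAlg a ⊗ₜ[k] 1) * F) {Ψ : A →ₗ[k] R}
    (hΨ : Ψ ∈ CA.homs CR) : evalL R (ε ∘ₗ Ψ) ∘ₗ D = Ψ := by
  refine LinearMap.ext fun a => M.incl_injective ?_
  have h := M.harpoon_counit_comp hCA hCR hε hΨ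
  rw [← h a]
  exact M.incl_evalL_legF hF hD (fun b => h b ▸ M.incl_mem (Ψ b)) a

theorem evalL_comp_legF_mem (hB : B.RightFull) {CA : RightComodule B A} {CR : RightComodule B R}
    (hCA : CA.IsRegular) (hCR : M.IsBase CR) {F : Multiplier k (A ⊗[k] A)} (hF : B.IsF F)
    {D : A →ₗ[k] A ⊗[k] R}
    (hD : ∀ a, M.algTensor (D a) = tensorMultiplier (ofAlg a ⊗ₜ[k] 1) * F) {ψ : A →ₗ[k] k}
    (hψ : ψ ∈ B.rightIntegrals) : evalL R ψ ∘ₗ D ∈ CA.homs CR := by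
  have h : ∀ a, M.incl ((evalL R ψ ∘ₗ D) a) = B.harpoon a ψ := fun a => by
    rw [LinearMap.comp_apply]
    exact M.incl_evalL_legF hF hD hψ a
  exact M.mem_homs_of_harpoon hB hCA hCR h

/-- The linear isomorphism `Ψ ↦ ε Ψ` from the comodule homomorphisms to the right integrals. -/
noncomputable def homsEquiv (hB : B.RightFull) {CA : RightComodule B A} {CR : RightComodule B R}
    (hCA : CA.IsRegular) (hCR : M.IsBase CR) {ε : R →ₗ[k] k} (hε : ε ∘ₗ M.proj = B.counit)
    {F : Multiplier k (A ⊗[k] A)} (hF : B.IsF F) {D : A →ₗ[k] A ⊗[k] R}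
    (hD : ∀ a, M.algTensor (D a) = tensorMultiplier (ofAlg a ⊗ₜ[k] 1) * F) :
    CA.homs CR ≃ₗ[k] B.rightIntegrals where
  toFun Ψ := ⟨ε ∘ₗ Ψ, fun a => by
    exact (M.harpoon_counit_comp hCA hCR hε Ψ.2 a).symm ▸ M.incl_mem (Ψ.1 a)⟩
  map_add' Φ Ψ := Subtype.ext (LinearMap.comp_add _ _ _)
  map_smul' c Ψ := Subtype.ext (LinearMap.comp_smul _ _ _)
  invFun ψ := ⟨evalL R ψ.1 ∘ₗ D, M.evalL_comp_legF_mem hB hCA hCR hF hD ψ.2⟩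
  left_inv Ψ := Subtype.ext (M.evalL_counit_comp_legF hCA hCR hε hF hD Ψ.2)
  right_inv ψ := Subtype.ext (LinearMap.ext fun a => M.counit_evalL_legF hF hD hε ψ.1 a)

theorem exists_homsEquiv (hB : B.RightFull) {CA : RightComodule B A} {CR : RightComodule B R}
    (hCA : CA.IsRegular) (hCR : M.IsBase CR) {ε : R →ₗ[k] k} (hε : ε ∘ₗ M.proj = B.counit)
    {F : Multiplier k (A ⊗[k] A)} (hF : B.IsF F) : ∃ e : CA.homs CR ≃ₗ[k] B.rightIntegrals,
      (∀ Ψ : CA.homs CR, (e Ψ : A →ₗ[k] k) = ε ∘ₗ (Ψ : A →ₗ[k] R)) ∧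
      (∀ (ψ : B.rightIntegrals) (D : A →ₗ[k] A ⊗[k] R),
        (∀ a, M.algTensor (D a) = tensorMultiplier (ofAlg a ⊗ₜ[k] 1) * F) →
        (e.symm ψ : A →ₗ[k] R) = evalL R (ψ : A →ₗ[k] k) ∘ₗ D) := by
  obtain ⟨D, hD, hD'⟩ := M.existsUnique_legF hF
  refine ⟨M.homsEquiv hB hCA hCR hε hF hD, fun _ => rfl, fun ψ D' h => ?_⟩
  rw [hD' D' h]
  rfl

end BaseModel

/-- The base itself. -/
noncomputable def RegularWeakMultiplierBialgebra.baseModel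
    (B : RegularWeakMultiplierBialgebra k A) : BaseModel B B.base where
  incl := B.base.subtype
  proj := B.piR.rangeRestrict
  incl_injective := B.base.injective_subtype
  proj_surjective := B.piR.surjective_rangeRestrict
  incl_comp_proj := rfl

end Integrals

end WMB

theorem mainTheorem5 {k : Type*} [Field k] {A : Type*} [NonUnitalRing A] [Module k A]
    [IsScalarTower k A A] [SMulCommClass k A A]
    (B : WMB.RegularWeakMultiplierBialgebra k A) (hB : B.RightFull) :
    -- the comodules `A` and `R`, the counit `ε` of `R` and the multiplier `F` exist
    (∃! CA : WMB.RightComodule B A, CA.IsRegular) ∧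
    (∃! CR : WMB.RightComodule B B.base, CR.IsBase) ∧
    (∃! ε : B.base →ₗ[k] k, B.IsBaseCounit ε) ∧
    (∃! F : WMB.Multiplier k (A ⊗[k] A), B.IsF F) ∧
    ∀ (CA : WMB.RightComodule B A) (CR : WMB.RightComodule B B.base) (ε : B.base →ₗ[k] k)
      (F : WMB.Multiplier k (A ⊗[k] A)),
      CA.IsRegular → CR.IsBase → B.IsBaseCounit ε → B.IsF F →
      -- the map `(- ⊗ 1) F : A → A ⊗ R` exists
      (∃! D : A →ₗ[k] A ⊗[k] B.base, B.IsLegF F D) ∧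
      -- the linear isomorphism `Ψ ↦ ε Ψ`, with inverse `ψ ↦ (ψ ⊗ R) ((- ⊗ 1) F)`
      ∃ e : CA.homs CR ≃ₗ[k] B.rightIntegrals,
        (∀ Ψ : CA.homs CR, (e Ψ : A →ₗ[k] k) = ε ∘ₗ (Ψ : A →ₗ[k] B.base)) ∧
        (∀ (ψ : B.rightIntegrals) (D : A →ₗ[k] A ⊗[k] B.base), B.IsLegF F D →
          (e.symm ψ : A →ₗ[k] B.base) = WMB.evalL B.base (ψ : A →ₗ[k] k) ∘ₗ D) := by
  refine ⟨⟨B.regularComodule, ⟨rfl, rfl⟩, fun C hC => WMB.RightComodule.ext' hC.1 hC.2⟩,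
    B.baseModel.existsUnique_comodule hB, B.existsUnique_baseCounit B.baseModel,
    B.existsUnique_F, fun CA CR ε F hCA hCR hε hF => ⟨B.baseModel.existsUnique_legF hF, ?_⟩⟩
  have hε' : ε ∘ₗ B.baseModel.proj = B.counit := LinearMap.ext fun a => hε a _ rfl
  exact B.baseModel.exists_homsEquiv hB hCA hCR hε' hF
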